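/- Let $Z=(Z_H(t))_{(t,H)\in[0,\infty)\times(0,1)}$ be the fractional Gaussian field on a probability space $(\Omega,\mathcal F,\mathbb P)$, that is, a centered Gaussian process with covariance $$\mathbb E[Z_H(t)Z_{H'}(s)]=\frac{a_{H,H'}}{2}\left\{|t|^{H+H'}+|s|^{H+H'}-|t-s|^{H+H'}\right\},$$ where, for $H+H'\neq 1$, $$a_{H,H'}=-\tfrac{2}{\pi}\sqrt{\Gamma(2H+1)\sin(\pi H)}\sqrt{\Gamma(2H'+1)\sin(\pi H')}\;\Gamma(-(H+H'))\cos\left((H'-H)\tfrac{\pi}{2}\right)\cos\left((H+H')\tfrac{\pi}{2}\right),$$ and, for $H+H'=1$, $a_{H,H'}=a_H:=\sqrt{\Gamma(2H+1)\Gamma(3-2H)}\,\sin^2(\pi H)$. Fix $H\in(0,1)$ with $H\neq\frac12$, let $\mathcal F_t^H=\sigma(Z_H(r):0\le r\le t)$, and let $(M_t)_{t\ge 0}$ be a jointly measurable version (up to null sets) of the process $M_t=\mathbb E[Z_{1-H}(t)\mid\mathcal F_t^H]$. Put $$c_M=\frac{a_H^2\,\Gamma(3/2-H)}{2H\,\Gamma(H+1/2)\,\Gamma(3-2H)},\qquad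 c_\Psi=\frac{2H\,\Gamma(3-2H)\,\Gamma(H+1/2)}{a_H\,\Gamma(3/2-H)},\qquad C=c_\Psi\sqrt{c_M(2-2H)},$$ and, for $\mu\in\mathbb R$, $r>0$, $\sigma>0$, $$A=\frac{\mu-r}{\sigma C},\qquad B=\frac{c_\Psi(2H-1)}{C}.$$ Let $T>0$ and $\epsilon>e^{-1/(2B^2c_M)}\,T$, and let $$\gamma_t=A\,t^{1/2-H}+B\,t^{H-3/2}M_t\,\mathbf 1_{[\epsilon,\infty)}(t).$$ Then, for all $0<t\le T$, one has $\int_0^t\gamma_s^2\,ds<\infty$ almost surely and $$\mathbb E\left[\exp\left(\frac12\int_0^t\gamma_s^2\,ds\right)\right]<\infty .$$ -/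

import Mathlib

open MeasureTheory ProbabilityTheory

/-- `a_H`, the value of `a_{H,H'}` when `H + H' = 1`. -/
noncomputable def aConst (H : ℝ) : ℝ :=
  √(Real.Gamma (2 * H + 1) * Real.Gamma (3 - 2 * H)) * Real.sin (Real.pi * H) ^ 2

/-- `a_{H,H'}`, the constant in the covariance of the fractional Gaussian field. -/
noncomputable def fieldConst (H H' : ℝ) : ℝ :=
  if H + H' = 1 then
    aConst H
  else
    -(2 / Real.pi) * √(Real.Gamma (2 * H + 1) * Real.sin (Real.pi * H))
      * √(Real.Gamma (2 * H' + 1) * Real.sin (Real.pi * H'))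
      * Real.Gamma (-(H + H')) * Real.cos ((H' - H) * (Real.pi / 2))
      * Real.cos ((H + H') * (Real.pi / 2))

/-- `Z H t ω`, for `H ∈ (0,1)` and `t ∈ [0,∞)`, is the fractional Gaussian field: a centered
Gaussian process indexed by the pairs `(H,t)`, with the prescribed covariance. The values of `Z`
at other arguments are irrelevant. -/
structure IsFractionalGaussianField {Ω : Type*} [MeasurableSpace Ω] (Z : ℝ → ℝ → Ω → ℝ)
    (P : Measure Ω) : Prop where
  measurable : ∀ H ∈ Set.Ioo (0 : ℝ) 1, ∀ t ∈ Set.Ici (0 : ℝ), Measurable (Z H t)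
  gaussian : IsGaussianProcess
    (fun p : Set.Ioo (0 : ℝ) 1 × Set.Ici (0 : ℝ) => Z (p.1 : ℝ) (p.2 : ℝ)) P
  centered : ∀ H ∈ Set.Ioo (0 : ℝ) 1, ∀ t ∈ Set.Ici (0 : ℝ), ∫ ω, Z H t ω ∂P = 0
  covariance : ∀ H ∈ Set.Ioo (0 : ℝ) 1, ∀ H' ∈ Set.Ioo (0 : ℝ) 1,
    ∀ t ∈ Set.Ici (0 : ℝ), ∀ s ∈ Set.Ici (0 : ℝ),
      ∫ ω, Z H t ω * Z H' s ω ∂P =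
        fieldConst H H' / 2 * (|t| ^ (H + H') + |s| ^ (H + H') - |t - s| ^ (H + H'))

/-- `ℱ_t^H = σ(Z_H(r) : 0 ≤ r ≤ t)`. -/
abbrev fieldSigmaAlgebra {Ω : Type*} (Z : ℝ → ℝ → Ω → ℝ) (H t : ℝ) : MeasurableSpace Ω :=
  ⨆ r ∈ Set.Icc (0 : ℝ) t, MeasurableSpace.comap (Z H r) inferInstance

/-- `M` is the process `M_H(t) = E[Z_{1-H}(t) | ℱ_t^H]`, `t ≥ 0`. A conditional expectation is
only determined almost surely for each single `t`; for the path integrals of `M` to make sense,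
the versions are chosen so that `(t,ω) ↦ M_H(t)(ω)` is jointly measurable (up to a null set). -/
structure IsFieldMartingale {Ω : Type*} [MeasurableSpace Ω] (Z : ℝ → ℝ → Ω → ℝ)
    (P : Measure Ω) (H : ℝ) (M : ℝ → Ω → ℝ) : Prop where
  jointly_measurable : AEMeasurable (fun p : ℝ × Ω => M p.1 p.2)
    ((volume.restrict (Set.Ici (0 : ℝ))).prod P)
  condExp_eq : ∀ t ∈ Set.Ici (0 : ℝ), M t =ᵐ[P] P[Z (1 - H) t | fieldSigmaAlgebra Z H t]

/-- `c_M`. -/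
noncomputable def cM (H : ℝ) : ℝ :=
  aConst H ^ 2 * Real.Gamma (3 / 2 - H)
    / (2 * H * Real.Gamma (H + 1 / 2) * Real.Gamma (3 - 2 * H))

/-- `c_Ψ`. -/
noncomputable def cPsi (H : ℝ) : ℝ :=
  2 * H * Real.Gamma (3 - 2 * H) * Real.Gamma (H + 1 / 2)
    / (aConst H * Real.Gamma (3 / 2 - H))

/-- `C = c_Ψ √(c_M (2 - 2H))`. -/
noncomputable def volConst (H : ℝ) : ℝ := cPsi H * √(cM H * (2 - 2 * H))

/-- `A = (μ - r) / (σ C)`. -/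
noncomputable def driftA (H μ r σ : ℝ) : ℝ := (μ - r) / (σ * volConst H)

/-- `B = c_Ψ (2H - 1) / C`. -/
noncomputable def driftB (H : ℝ) : ℝ := cPsi H * (2 * H - 1) / volConst H

/-- `γ_t = A t^{1/2-H} + B t^{H-3/2} M_t 1_{[ε,∞)}(t)`. -/
noncomputable def driftCorrection {Ω : Type*} (H μ r σ ε : ℝ) (M : ℝ → Ω → ℝ) (t : ℝ) (ω : Ω) :
    ℝ :=
  driftA H μ r σ * t ^ (1 / 2 - H)
    + driftB H * t ^ (H - 3 / 2) * M t ω * (Set.Ici ε).indicator (fun _ => (1 : ℝ)) t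

/-! The projection of `Z_{1-H}(t)` onto the closed span of `Z_H(r)`, `r ≤ t`, leaves a residual
orthogonal to that span. By joint Gaussianity the residual is independent of `ℱ_t^H`, so `M_t` is
this projection and is centered Gaussian. The key estimate is `Var M_t ≤ 2 c_M t^{2-2H}`
(`fieldMartingale_map`).

The norm of the projection is the norm of a functional. Since the exponents `H` and `1-H` sum to
one, `E[Z_{1-H}(t) Z_H(s)] = a_H s` for `s ≤ t`, so what matters is the size of the functional
`Z_H(s) ↦ s`. Let `z_s` in `L²(ℝ)` have Gram matrix proportional to the fractional Brownian
covariance, and let `w` satisfy `⟨w, z_s⟩ = s`; then Cauchy–Schwarz bounds the functional by `‖w‖`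
(`sq_sum_le_of_features`). For `H < 1/2` the `z_s` are Mandelbrot–Van Ness kernels, for `H > 1/2`
Molchan–Golosov kernels; in both cases `w` is a power function on `(0,t)`, and everything reduces to
beta integrals. The second choice gives the constant `c_M`; the first gives a constant which
`Gamma_two_mul_sq_le` bounds by `2 c_M`.

For the exponential moment, put `L = log (t/ε)`. Jensen's inequality for the probability measure
`ds/(sL)` on `[ε,t]` reduces the claim to bounding `E exp((b L / 2) s^{2H-2} M_s²)` uniformly in
`s`, with `b` slightly above `B²`. By the variance bound this holds when `b c_M L < 1/2`. The
hypothesis on `ε` says `B² c_M log (T/ε) < 1/2`, so the factor 2 in the variance is affordable, and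
strictness leaves room to split off the deterministic drift `A s^{1/2-H}`. -/

/-! ### Substitutions and beta integrals. -/

open Set in
-- The substitution is `1/u = 1/v + y`. It sends `v - u` and `v' - u` to multiples of `y` and `y +
-- const`, so that products of such powers become beta integrals of the second kind.
theorem lintegral_Ioo_inversion {v : ℝ} (hv : 0 < v) (g : ℝ → ENNReal) :
    ∫⁻ u in Ioo 0 v, g u =
      ∫⁻ y in Ioi (0 : ℝ), ENNReal.ofReal (v ^ 2 / (1 + v * y) ^ 2) * g (v / (1 + v * y)) := by
  have himg : (fun y : ℝ => v / (1 + v * y)) '' Ioi 0 = Ioo 0 v := by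
    ext u
    constructor
    · rintro ⟨y, hy, rfl⟩
      have hy' : (0 : ℝ) < y := hy
      have : 0 < v * y := mul_pos hv hy'
      refine ⟨by positivity, ?_⟩
      show v / (1 + v * y) < v
      rw [div_lt_iff₀ (by positivity)]
      nlinarith
    · rintro ⟨h0, h1⟩
      refine ⟨1 / u - 1 / v, ?_, ?_⟩
      · exact sub_pos.2 (one_div_lt_one_div_of_lt h0 h1)
      · have := hv.ne'
        have := h0.ne'
        show v / (1 + v * (1 / u - 1 / v)) = u
        field_simp
        ring
  have hderiv : ∀ y ∈ Ioi (0 : ℝ), HasDerivWithinAt (fun y : ℝ => v / (1 + v * y))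
      (-(v ^ 2 / (1 + v * y) ^ 2)) (Ioi 0) y := by
    intro y hy
    have hy' : (0 : ℝ) < y := hy
    have hne : 1 + v * y ≠ 0 := by positivity
    have h1 : HasDerivAt (fun y : ℝ => 1 + v * y) v y := by
      simpa using ((hasDerivAt_id y).const_mul v).const_add 1
    have h2 := (hasDerivAt_const y v).div h1 hne
    have h3 := h2.hasDerivWithinAt (s := Ioi (0 : ℝ))
    rw [show (0 * (1 + v * y) - v * v) / (1 + v * y) ^ 2 = -(v ^ 2 / (1 + v * y) ^ 2) by
      ring] at h3
    exact h3
  have hinj : InjOn (fun y : ℝ => v / (1 + v * y)) (Ioi 0) := by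
    intro a ha b hb hab
    have ha' : (0 : ℝ) < a := ha
    have hb' : (0 : ℝ) < b := hb
    have h1 : 1 + v * a ≠ 0 := by positivity
    have h2 : 1 + v * b ≠ 0 := by positivity
    simp only at hab
    rw [div_eq_div_iff h1 h2] at hab
    have := mul_left_cancel₀ hv.ne' hab
    have : v * b = v * a := by linarith
    exact (mul_left_cancel₀ hv.ne' this).symm
  rw [← himg, lintegral_image_eq_lintegral_abs_deriv_mul measurableSet_Ioi hderiv hinj]
  refine setLIntegral_congr_fun measurableSet_Ioi fun y hy => ?_
  have hy' : (0 : ℝ) < y := hy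
  simp only [abs_neg]
  rw [abs_of_nonneg (by positivity)]

open Set in
theorem lintegral_beta {a b : ℝ} (ha : 0 < a) (hb : 0 < b) :
    ∫⁻ x in Ioo (0 : ℝ) 1, ENNReal.ofReal (x ^ (a - 1) * (1 - x) ^ (b - 1)) =
      ENNReal.ofReal (beta a b) := by
  have h := lintegral_betaPDF_eq_one ha hb
  rw [lintegral_betaPDF] at h
  have hB := beta_pos ha hb
  have h2 : ∫⁻ x in Ioo (0 : ℝ) 1, ENNReal.ofReal (1 / beta a b * x ^ (a - 1) * (1 - x) ^ (b - 1))
      = ENNReal.ofReal (1 / beta a b) *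
        ∫⁻ x in Ioo (0 : ℝ) 1, ENNReal.ofReal (x ^ (a - 1) * (1 - x) ^ (b - 1)) := by
    rw [← lintegral_const_mul' _ _ ENNReal.ofReal_ne_top]
    congr 1
    ext x
    rw [← ENNReal.ofReal_mul (by positivity), mul_assoc]
  rw [h2] at h
  have h3 : ENNReal.ofReal (beta a b) * ENNReal.ofReal (1 / beta a b) = 1 := by
    rw [← ENNReal.ofReal_mul hB.le, mul_one_div_cancel hB.ne', ENNReal.ofReal_one]
  calc _ = ENNReal.ofReal (beta a b) * ENNReal.ofReal (1 / beta a b) *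
        ∫⁻ x in Ioo (0 : ℝ) 1, ENNReal.ofReal (x ^ (a - 1) * (1 - x) ^ (b - 1)) := by
          rw [h3, one_mul]
    _ = _ := by rw [mul_assoc, h, mul_one]

open Set in
/-- Linear substitution `u = c x` on `(0, c b)`. -/
theorem lintegral_Ioo_scale {c b : ℝ} (hc : 0 < c) (g : ℝ → ENNReal) :
    ∫⁻ u in Ioo 0 (c * b), g u = ENNReal.ofReal c * ∫⁻ x in Ioo 0 b, g (c * x) := by
  have himg : (fun x : ℝ => c * x) '' Ioo 0 b = Ioo 0 (c * b) := by
    simpa using image_mul_left_Ioo hc 0 b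
  have hderiv : ∀ x ∈ Ioo (0 : ℝ) b, HasDerivWithinAt (fun x : ℝ => c * x) c (Ioo 0 b) x := by
    intro x _
    simpa using ((hasDerivAt_id x).const_mul c).hasDerivWithinAt
  rw [← himg, lintegral_image_eq_lintegral_abs_deriv_mul measurableSet_Ioo hderiv
    (fun a _ b _ h => mul_left_cancel₀ hc.ne' h), abs_of_pos hc,
    lintegral_const_mul' _ _ ENNReal.ofReal_ne_top]

open Set in
theorem lintegral_Ioi_scale {c : ℝ} (hc : 0 < c) (g : ℝ → ENNReal) :
    ∫⁻ u in Ioi 0, g u = ENNReal.ofReal c * ∫⁻ x in Ioi (0 : ℝ), g (c * x) := by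
  have himg : (fun x : ℝ => c * x) '' Ioi 0 = Ioi 0 := by
    simpa using image_mul_left_Ioi hc 0
  have hderiv : ∀ x ∈ Ioi (0 : ℝ), HasDerivWithinAt (fun x : ℝ => c * x) c (Ioi 0) x := by
    intro x _
    simpa using ((hasDerivAt_id x).const_mul c).hasDerivWithinAt
  conv_lhs => rw [← himg]
  rw [lintegral_image_eq_lintegral_abs_deriv_mul measurableSet_Ioi hderiv
    (fun a _ b _ h => mul_left_cancel₀ hc.ne' h), abs_of_pos hc,
    lintegral_const_mul' _ _ ENNReal.ofReal_ne_top]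

open Set in
theorem lintegral_beta_scaled {a b s : ℝ} (ha : 0 < a) (hb : 0 < b) (hs : 0 < s) :
    ∫⁻ u in Ioo (0 : ℝ) s, ENNReal.ofReal (u ^ (a - 1) * (s - u) ^ (b - 1)) =
      ENNReal.ofReal (s ^ (a + b - 1) * beta a b) := by
  have h := lintegral_Ioo_scale (b := 1) hs
    (fun u => ENNReal.ofReal (u ^ (a - 1) * (s - u) ^ (b - 1)))
  rw [mul_one] at h
  rw [h, ENNReal.ofReal_mul (by positivity), ← lintegral_beta ha hb,
    ← lintegral_const_mul' _ _ ENNReal.ofReal_ne_top,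
    ← lintegral_const_mul' _ _ ENNReal.ofReal_ne_top]
  refine setLIntegral_congr_fun measurableSet_Ioo fun x hx => ?_
  rw [← ENNReal.ofReal_mul hs.le, ← ENNReal.ofReal_mul (by positivity)]
  congr 1
  rw [show s - s * x = s * (1 - x) by ring, Real.mul_rpow hs.le hx.1.le,
    Real.mul_rpow hs.le (by linarith [hx.2]), show a + b - 1 = 1 + (a - 1) + (b - 1) by ring,
    Real.rpow_add hs, Real.rpow_add hs, Real.rpow_one]
  ring

open Set in
theorem lintegral_Ioi_beta {a b : ℝ} (ha : 0 < a) (hb : 0 < b) :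
    ∫⁻ y in Ioi (0 : ℝ), ENNReal.ofReal (y ^ (b - 1) * (y + 1) ^ (-(a + b))) =
      ENNReal.ofReal (beta a b) := by
  rw [← lintegral_beta ha hb, lintegral_Ioo_inversion one_pos]
  refine setLIntegral_congr_fun measurableSet_Ioi fun y hy => ?_
  have hy' : (0 : ℝ) < y := hy
  rw [← ENNReal.ofReal_mul (by positivity)]
  congr 1
  have h1 : (0 : ℝ) < y + 1 := by positivity
  rw [show 1 - 1 / (1 + 1 * y) = y / (y + 1) by field_simp; ring,
    show 1 / (1 + 1 * y) = (y + 1)⁻¹ by rw [one_mul, one_div, add_comm],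
    Real.inv_rpow h1.le, ← Real.rpow_neg h1.le, Real.div_rpow hy'.le h1.le,
    show (1 : ℝ) ^ 2 / (1 + 1 * y) ^ 2 = (y + 1) ^ (-2 : ℝ) by
      rw [Real.rpow_neg h1.le, Real.rpow_two]; rw [one_mul, add_comm]; field_simp,
    div_eq_mul_inv, ← Real.rpow_neg h1.le,
    show -(a + b) = -2 + -(a - 1) + -(b - 1) by ring, Real.rpow_add h1, Real.rpow_add h1]
  ring

open Set in
theorem lintegral_Ioi_beta_scaled {a b d : ℝ} (ha : 0 < a) (hb : 0 < b) (hd : 0 < d) :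
    ∫⁻ y in Ioi (0 : ℝ), ENNReal.ofReal (y ^ (b - 1) * (y + d) ^ (-(a + b))) =
      ENNReal.ofReal (d ^ (-a) * beta a b) := by
  rw [lintegral_Ioi_scale hd, ENNReal.ofReal_mul (by positivity), ← lintegral_Ioi_beta ha hb,
    ← lintegral_const_mul' _ _ ENNReal.ofReal_ne_top,
    ← lintegral_const_mul' _ _ ENNReal.ofReal_ne_top]
  refine setLIntegral_congr_fun measurableSet_Ioi fun y hy => ?_
  have hy' : (0 : ℝ) < y := hy
  rw [← ENNReal.ofReal_mul hd.le, ← ENNReal.ofReal_mul (by positivity)]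
  congr 1
  rw [show d * y + d = d * (y + 1) by ring, Real.mul_rpow hd.le hy'.le,
    Real.mul_rpow hd.le (by positivity), show -a = 1 + (b - 1) + -(a + b) by ring,
    Real.rpow_add hd, Real.rpow_add hd, Real.rpow_one]
  ring

/-! ### Increments of powers and the Mandelbrot–Van Ness kernel. -/

open Set in
theorem lintegral_Ioo_rpow_add {u d β : ℝ} (hu : 0 < u) (hd : 0 ≤ d) (hβ : β < 0) :
    ∫⁻ x in Ioo 0 d, ENNReal.ofReal (-β * (u + x) ^ (β - 1)) =
      ENNReal.ofReal (u ^ β - (u + d) ^ β) := by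
  have hint : IntervalIntegrable (fun x : ℝ => -β * (u + x) ^ (β - 1)) volume 0 d := by
    apply ContinuousOn.intervalIntegrable
    refine continuousOn_const.mul (ContinuousOn.rpow_const (by fun_prop) ?_)
    intro x hx
    rw [uIcc_of_le hd] at hx
    left
    linarith [hx.1]
  rw [restrict_Ioo_eq_restrict_Ioc, ← ofReal_integral_eq_lintegral_ofReal, ←
    intervalIntegral.integral_of_le hd]
  · congr 1
    have h := intervalIntegral.integral_eq_sub_of_hasDerivAt (a := 0) (b := d)
      (f := fun x : ℝ => -(u + x) ^ β) (f' := fun x : ℝ => -β * (u + x) ^ (β - 1)) ?_ hint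
    · rw [h, add_zero]
      ring
    · intro x hx
      rw [uIcc_of_le hd] at hx
      have h1 : HasDerivAt (fun x : ℝ => u + x) 1 x := (hasDerivAt_id x).const_add u
      have h2 := (h1.rpow_const (p := β) (Or.inl (by linarith [hx.1]))).neg
      rw [show -(1 * β * (u + x) ^ (β - 1)) = -β * (u + x) ^ (β - 1) by ring] at h2
      exact h2
  · exact (intervalIntegrable_iff_integrableOn_Ioc_of_le hd).1 hint
  · refine (ae_restrict_iff' measurableSet_Ioc).2 (Filter.Eventually.of_forall fun x hx => ?_)
    have : 0 < u + x := by linarith [hx.1]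
    have := Real.rpow_nonneg this.le (β - 1)
    simp only [Pi.zero_apply]
    nlinarith

open Set in
-- The increment is the integral of its derivative over `(0,d)`; Tonelli then exchanges the two
-- integrations, leaving a beta integral in `u` for each fixed `x`.
theorem lintegral_mul_rpow_sub_rpow {d β : ℝ} (hd : 0 ≤ d) (hβ : β < 0) {h : ℝ → ℝ}
    (hm : Measurable h) (h0 : ∀ u ∈ Ioi (0 : ℝ), 0 ≤ h u) :
    ∫⁻ u in Ioi (0 : ℝ), ENNReal.ofReal (h u * (u ^ β - (u + d) ^ β)) =
      ∫⁻ x in Ioo 0 d, ∫⁻ u in Ioi (0 : ℝ), ENNReal.ofReal (h u * (-β * (u + x) ^ (β - 1))) := by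
  rw [lintegral_lintegral_swap (by fun_prop)]
  refine setLIntegral_congr_fun measurableSet_Ioi fun u hu => ?_
  simp only [ENNReal.ofReal_mul (h0 u hu)]
  rw [lintegral_const_mul' _ _ ENNReal.ofReal_ne_top, lintegral_Ioo_rpow_add hu hd hβ]

open Set in
theorem lintegral_Ioo_rpow {d p : ℝ} (hd : 0 ≤ d) (hp : -1 < p) :
    ∫⁻ x in Ioo 0 d, ENNReal.ofReal (x ^ p) = ENNReal.ofReal (d ^ (p + 1) / (p + 1)) := by
  have hint : IntervalIntegrable (fun x : ℝ => x ^ p) volume 0 d :=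
    intervalIntegral.intervalIntegrable_rpow' hp
  rw [restrict_Ioo_eq_restrict_Ioc, ← ofReal_integral_eq_lintegral_ofReal, ←
    intervalIntegral.integral_of_le hd, integral_rpow (Or.inl hp), Real.zero_rpow (by linarith),
    sub_zero]
  · exact (intervalIntegrable_iff_integrableOn_Ioc_of_le hd).1 hint
  · exact (ae_restrict_iff' measurableSet_Ioc).2 (Filter.Eventually.of_forall fun x hx =>
      Real.rpow_nonneg hx.1.le _)

/-- The squared `L²` norm of the unit increment of the Mandelbrot–Van Ness kernel with exponent
`α`. -/
noncomputable def mvnConst (α : ℝ) : ℝ := 2 * (-α * beta (-2 * α) (1 + α) / (2 * α + 1))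

theorem mvnConst_pos {α : ℝ} (h1 : -(1 / 2) < α) (h0 : α < 0) : 0 < mvnConst α := by
  have h2 : 0 < 2 * α + 1 := by linarith
  have h3 := beta_pos (α := -2 * α) (β := 1 + α) (by linarith) (by linarith)
  have h4 : 0 < -α := by linarith
  unfold mvnConst
  positivity

open Set in
theorem lintegral_rpow_mul_rpow_sub_rpow {α d : ℝ} (h1 : -(1 / 2) < α) (h0 : α < 0)
    (hd : 0 ≤ d) :
    ∫⁻ u in Ioi (0 : ℝ), ENNReal.ofReal (u ^ α * (u ^ α - (u + d) ^ α)) =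
      ENNReal.ofReal (mvnConst α / 2 * d ^ (2 * α + 1)) := by
  have hb := beta_pos (α := -2 * α) (β := 1 + α) (by linarith) (by linarith)
  rw [lintegral_mul_rpow_sub_rpow hd h0 (by fun_prop) fun u hu => Real.rpow_nonneg (le_of_lt hu) _]
  have h : ∀ x ∈ Ioo 0 d,
      ∫⁻ u in Ioi (0 : ℝ), ENNReal.ofReal (u ^ α * (-α * (u + x) ^ (α - 1))) =
        ENNReal.ofReal (-α * beta (-2 * α) (1 + α)) * ENNReal.ofReal (x ^ (2 * α)) := by
    intro x hx
    rw [ENNReal.ofReal_mul (by linarith), mul_assoc, ← ENNReal.ofReal_mul hb.le,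
      mul_comm (beta _ _), show x ^ (2 * α) = x ^ (-(-2 * α)) by congr 1; ring,
      ← lintegral_Ioi_beta_scaled (by linarith) (by linarith) hx.1,
      ← lintegral_const_mul' _ _ ENNReal.ofReal_ne_top]
    refine lintegral_congr fun u => ?_
    rw [← ENNReal.ofReal_mul (by linarith)]
    congr 1
    rw [show 1 + α - 1 = α by ring, show -(-2 * α + (1 + α)) = α - 1 by ring]
    ring
  rw [setLIntegral_congr_fun measurableSet_Ioo h, lintegral_const_mul' _ _ ENNReal.ofReal_ne_top,
    lintegral_Ioo_rpow hd (by linarith), ← ENNReal.ofReal_mul (by nlinarith)]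
  congr 1
  unfold mvnConst
  ring

open Set in
theorem lintegral_rpow_sub_rpow {β d : ℝ} (h1 : -1 < β) (h0 : β < 0)
    (hd : 0 ≤ d) :
    ∫⁻ u in Ioi (0 : ℝ), ENNReal.ofReal (u ^ β - (u + d) ^ β) =
      ENNReal.ofReal (d ^ (β + 1) / (β + 1)) := by
  have h2 := lintegral_mul_rpow_sub_rpow hd h0 (h := fun _ => 1) (by fun_prop)
    fun u hu => zero_le_one
  simp only [one_mul] at h2
  rw [h2, ← lintegral_Ioo_rpow hd h1]
  refine setLIntegral_congr_fun measurableSet_Ioo fun x hx => ?_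
  have h3 := lintegral_Ioi_beta_scaled (a := -β) (b := 1) (by linarith) one_pos hx.1
  have h4 : beta (-β) 1 = 1 / -β := by
    have : Real.Gamma (-β) ≠ 0 := (Real.Gamma_pos_of_pos (by linarith)).ne'
    rw [beta, Real.Gamma_one, Real.Gamma_add_one (by linarith)]
    have : -β ≠ 0 := by linarith
    field_simp
  rw [h4] at h3
  simp only [sub_self, Real.rpow_zero, one_mul, neg_add, neg_neg] at h3
  have h5 : ∀ u : ℝ, ENNReal.ofReal (-β * (u + x) ^ (β - 1)) =
      ENNReal.ofReal (-β) * ENNReal.ofReal ((u + x) ^ (β + -1)) := by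
    intro u
    rw [ENNReal.ofReal_mul (by linarith), sub_eq_add_neg]
  simp only [h5]
  rw [lintegral_const_mul' _ _ ENNReal.ofReal_ne_top, h3, ← ENNReal.ofReal_mul (by linarith)]
  congr 1
  have : β ≠ 0 := h0.ne
  field_simp

open Set in
-- With `a = u^α` and `b = (u+d)^α`, use `(a-b)² + (a²-b²) = 2a(a-b)`. The integrals of `a²-b²` and
-- of `a(a-b)` are already known, and the former equals the integral of `x^{2α}` over `(0,d)`, so no
-- divergent integral is ever split.
theorem lintegral_sq_rpow_sub_rpow {α d : ℝ} (h1 : -(1 / 2) < α) (h0 : α < 0)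
    (hd : 0 ≤ d) :
    (∫⁻ u in Ioi (0 : ℝ), ENNReal.ofReal ((u ^ α - (u + d) ^ α) ^ 2)) +
      ∫⁻ x in Ioo 0 d, ENNReal.ofReal (x ^ (2 * α)) =
      ENNReal.ofReal (mvnConst α * d ^ (2 * α + 1)) := by
  have hmono : ∀ u ∈ Ioi (0 : ℝ), (u + d) ^ α ≤ u ^ α := fun u hu =>
    Real.rpow_le_rpow_of_nonpos hu (by linarith) h0.le
  rw [lintegral_Ioo_rpow hd (by linarith),
    ← lintegral_rpow_sub_rpow (by linarith) (by linarith) hd,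
    ← lintegral_add_left (by fun_prop)]
  have h2 : ∀ u ∈ Ioi (0 : ℝ), ENNReal.ofReal ((u ^ α - (u + d) ^ α) ^ 2) +
      ENNReal.ofReal (u ^ (2 * α) - (u + d) ^ (2 * α)) =
        2 * ENNReal.ofReal (u ^ α * (u ^ α - (u + d) ^ α)) := by
    intro u hu
    have hu' : (0 : ℝ) < u := hu
    have hm := hmono u hu
    have h3 : 0 ≤ (u + d) ^ α := Real.rpow_nonneg (by linarith) _
    have e1 : u ^ (2 * α) = (u ^ α) ^ 2 := by
      rw [mul_comm, Real.rpow_mul hu'.le, Real.rpow_two]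
    have e2 : (u + d) ^ (2 * α) = ((u + d) ^ α) ^ 2 := by
      rw [mul_comm, Real.rpow_mul (by linarith), Real.rpow_two]
    rw [e1, e2, ← ENNReal.ofReal_add (sq_nonneg _) (by nlinarith),
      show (2 : ENNReal) = ENNReal.ofReal 2 by simp, ← ENNReal.ofReal_mul (by norm_num)]
    congr 1
    ring
  rw [setLIntegral_congr_fun measurableSet_Ioi h2, lintegral_const_mul' _ _ (by simp),
    lintegral_rpow_mul_rpow_sub_rpow h1 h0 hd, show (2 : ENNReal) = ENNReal.ofReal 2 by simp,
    ← ENNReal.ofReal_mul (by norm_num)]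
  congr 1
  ring

/-- The kernel `u ↦ (s - u)₊ ^ α`. -/
noncomputable def powerKernel (α s u : ℝ) : ℝ := if u < s then (s - u) ^ α else 0

theorem measurable_powerKernel (α s : ℝ) : Measurable (powerKernel α s) :=
  Measurable.ite measurableSet_Iio (by fun_prop) measurable_const

open Set in
theorem lintegral_sq_powerKernel_sub {α r s : ℝ} (h1 : -(1 / 2) < α) (h0 : α < 0) (hrs : r ≤ s) :
    ∫⁻ u, ENNReal.ofReal ((powerKernel α s u - powerKernel α r u) ^ 2) =
      ENNReal.ofReal (mvnConst α * (s - r) ^ (2 * α + 1)) := by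
  have hd : 0 ≤ s - r := by linarith
  -- After the reflection `u = r - y`, the half-line `y > 0` carries both kernels, while `-(s-r) < y
  -- ≤ 0` carries only the one at `s`; a shift by `s - r` moves the latter to `(0, s-r]`.
  rw [← lintegral_sub_left_eq_self _ r, ← lintegral_sq_rpow_sub_rpow h1 h0 hd,
    restrict_Ioo_eq_restrict_Ioc, ← lintegral_indicator measurableSet_Ioi,
    ← lintegral_indicator measurableSet_Ioc, ← lintegral_add_right_eq_self
      ((Ioc 0 (s - r)).indicator fun x => ENNReal.ofReal (x ^ (2 * α))) (s - r),
    ← lintegral_add_left (Measurable.indicator (by fun_prop) measurableSet_Ioi)]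
  refine lintegral_congr fun y => ?_
  unfold powerKernel
  rcases lt_or_ge 0 y with hy | hy
  · rw [if_pos (by linarith), if_pos (by linarith), indicator_of_mem (mem_Ioi.2 hy),
      indicator_of_notMem (by rintro ⟨_, h⟩; linarith), add_zero]
    congr 1
    rw [show s - (r - y) = y + (s - r) by ring, show r - (r - y) = y by ring]
    ring
  · rw [if_neg (by linarith : ¬ r - y < r), sub_zero,
      indicator_of_notMem (by simpa using hy : y ∉ Ioi 0), zero_add]
    by_cases h : r - y < s
    · rw [if_pos h, indicator_of_mem (mem_Ioc.2 ⟨by linarith, by linarith⟩), ← Real.rpow_natCast,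
        ← Real.rpow_mul (by linarith)]
      congr 2
      · ring
      · push_cast; ring
    · rw [if_neg h, indicator_of_notMem (by rintro ⟨h2, _⟩; linarith)]
      simp

/-! ### Feature maps and Cauchy–Schwarz; the case `H < 1/2`. -/

theorem memLp_two_of_lintegral_sq_lt_top {X : Type*} [MeasurableSpace X] {ν : Measure X} {f : X → ℝ}
    (hf : AEStronglyMeasurable f ν) (h : ∫⁻ x, ENNReal.ofReal (f x ^ 2) ∂ν < ⊤) :
    MemLp f 2 ν := by
  rw [memLp_two_iff_integrable_sq hf]
  refine ⟨by fun_prop, ?_⟩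
  rw [hasFiniteIntegral_iff_ofReal (Filter.Eventually.of_forall fun x => sq_nonneg _)]
  exact h

theorem integral_sq_eq_of_lintegral {X : Type*} [MeasurableSpace X] {ν : Measure X} {f : X → ℝ}
    (hf : AEStronglyMeasurable f ν) {c : ℝ} (hc : 0 ≤ c)
    (h : ∫⁻ x, ENNReal.ofReal (f x ^ 2) ∂ν = ENNReal.ofReal c) : ∫ x, f x ^ 2 ∂ν = c := by
  rw [integral_eq_lintegral_of_nonneg_ae (Filter.Eventually.of_forall fun x => sq_nonneg _)
    (by fun_prop), h, ENNReal.toReal_ofReal hc]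

/-- The covariance of fractional Brownian motion. -/
noncomputable def fbmCov (H s r : ℝ) : ℝ :=
  (|s| ^ (2 * H) + |r| ^ (2 * H) - |s - r| ^ (2 * H)) / 2

/-- Cauchy–Schwarz for a linear combination of square integrable functions. -/
theorem sq_sum_mul_integral_le {X ι : Type*} [MeasurableSpace X] {ν : Measure X} (I : Finset ι)
    (x : ι → ℝ) {z : ι → X → ℝ} {w : X → ℝ} (hz : ∀ i ∈ I, MemLp (z i) 2 ν) (hw : MemLp w 2 ν) :
    (∑ i ∈ I, x i * ∫ u, w u * z i u ∂ν) ^ 2 ≤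
      (∫ u, w u ^ 2 ∂ν) * ∑ i ∈ I, ∑ j ∈ I, x i * x j * ∫ u, z i u * z j u ∂ν := by
  set g : X → ℝ := fun u => ∑ i ∈ I, x i * z i u with hg
  have hgm : MemLp g 2 ν := memLp_finsetSum I fun i hi => (hz i hi).const_mul (x i)
  have e1 : ∑ i ∈ I, x i * ∫ u, w u * z i u ∂ν = ∫ u, w u * g u ∂ν := by
    simp only [← integral_const_mul]
    rw [← integral_finsetSum]
    · simp only [hg, Finset.mul_sum]
      congr 1; ext u
      exact Finset.sum_congr rfl fun i _ => by ring
    · intro i hi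
      exact (hw.integrable_mul (hz i hi)).const_mul _
  have e2 : ∑ i ∈ I, ∑ j ∈ I, x i * x j * ∫ u, z i u * z j u ∂ν = ∫ u, g u ^ 2 ∂ν := by
    have : ∀ u, g u ^ 2 = ∑ i ∈ I, ∑ j ∈ I, x i * x j * (z i u * z j u) := by
      intro u
      rw [sq, hg]
      simp only [Finset.sum_mul_sum]
      exact Finset.sum_congr rfl fun i _ => Finset.sum_congr rfl fun j _ => by ring
    simp only [this]
    rw [integral_finsetSum]
    · refine Finset.sum_congr rfl fun i hi => ?_
      rw [integral_finsetSum]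
      · exact Finset.sum_congr rfl fun j _ => (integral_const_mul _ _).symm
      · intro j hj
        exact ((hz i hi).integrable_mul (hz j hj)).const_mul _
    · intro i hi
      exact integrable_finsetSum _ fun j hj => ((hz i hi).integrable_mul (hz j hj)).const_mul _
  rw [e1, e2]
  have key := real_inner_mul_inner_self_le (hw.toLp w) (hgm.toLp g)
  have hi : ∀ {a b : X → ℝ} (ha : MemLp a 2 ν) (hb : MemLp b 2 ν),
      inner ℝ (ha.toLp a) (hb.toLp b) = ∫ u, a u * b u ∂ν := by
    intro a b ha hb
    rw [L2.inner_def]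
    refine integral_congr_ae ?_
    filter_upwards [ha.coeFn_toLp, hb.coeFn_toLp] with u h1 h2
    rw [h1, h2]
    simp [mul_comm]
  rw [hi hw hgm, hi hw hw, hi hgm hgm] at key
  simpa only [sq] using key

/-- A feature map for the covariance of fractional Brownian motion bounds the functional
`z_s ↦ s`. -/
theorem sq_sum_le_of_features {H t c W : ℝ} (z : ℝ → ℝ → ℝ) (w : ℝ → ℝ)
    (hz : ∀ s ∈ Set.Icc 0 t, MemLp (z s) 2) (hw : MemLp w 2)
    (hcov : ∀ s ∈ Set.Icc 0 t, ∀ r ∈ Set.Icc 0 t, ∫ u, z s u * z r u = c * fbmCov H s r)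
    (hwz : ∀ s ∈ Set.Icc 0 t, ∫ u, w u * z s u = s) (hww : ∫ u, w u ^ 2 = W)
    {ι : Type*} (I : Finset ι) (x s : ι → ℝ) (hs : ∀ i ∈ I, s i ∈ Set.Icc 0 t) :
    (∑ i ∈ I, x i * s i) ^ 2 ≤ W * c * ∑ i ∈ I, ∑ j ∈ I, x i * x j * fbmCov H (s i) (s j) := by
  have h := sq_sum_mul_integral_le I x (z := fun i => z (s i)) (w := w) (ν := volume)
    (fun i hi => hz _ (hs i hi)) hw
  rw [hww, Finset.sum_congr rfl fun i hi => by rw [hwz _ (hs i hi)]] at h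
  refine h.trans_eq ?_
  rw [mul_assoc, Finset.mul_sum (a := c)]
  congr 1
  refine Finset.sum_congr rfl fun i hi => ?_
  rw [Finset.mul_sum]
  refine Finset.sum_congr rfl fun j hj => ?_
  rw [hcov _ (hs i hi) _ (hs j hj)]
  ring

open Set in
theorem integral_sq_powerKernel_sub {α : ℝ} (h1 : -(1 / 2) < α) (h0 : α < 0) (r s : ℝ) :
    MemLp (fun u => powerKernel α s u - powerKernel α r u) 2 ∧
    ∫ u, (powerKernel α s u - powerKernel α r u) ^ 2 = mvnConst α * |s - r| ^ (2 * α + 1) := by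
  have hm : ∀ s r, AEStronglyMeasurable (fun u => powerKernel α s u - powerKernel α r u) :=
    fun s r =>
    ((measurable_powerKernel α s).sub (measurable_powerKernel α r)).aestronglyMeasurable
  have hV := mvnConst_pos h1 h0
  have h : ∫⁻ u, ENNReal.ofReal ((powerKernel α s u - powerKernel α r u) ^ 2) =
      ENNReal.ofReal (mvnConst α * |s - r| ^ (2 * α + 1)) := by
    rcases le_total r s with hrs | hrs
    · rw [lintegral_sq_powerKernel_sub h1 h0 hrs, abs_of_nonneg (by linarith)]
    · rw [abs_sub_comm, abs_of_nonneg (by linarith), ← lintegral_sq_powerKernel_sub h1 h0 hrs]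
      exact lintegral_congr fun u => by congr 1; ring
  exact ⟨memLp_two_of_lintegral_sq_lt_top (hm s r) (h ▸ ENNReal.ofReal_lt_top),
    integral_sq_eq_of_lintegral (hm s r) (by positivity) h⟩

open Set in
theorem integral_mvn_mul {α : ℝ} (h1 : -(1 / 2) < α) (h0 : α < 0) (s r : ℝ) :
    ∫ u, (powerKernel α s u - powerKernel α 0 u) * (powerKernel α r u - powerKernel α 0 u) =
      mvnConst α * fbmCov (α + 1 / 2) s r := by
  obtain ⟨ms, es⟩ := integral_sq_powerKernel_sub h1 h0 0 s
  obtain ⟨mr, er⟩ := integral_sq_powerKernel_sub h1 h0 0 r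
  obtain ⟨mm, em⟩ := integral_sq_powerKernel_sub h1 h0 r s
  have : ∀ u, (powerKernel α s u - powerKernel α 0 u) * (powerKernel α r u - powerKernel α 0 u) =
      ((powerKernel α s u - powerKernel α 0 u) ^ 2 + (powerKernel α r u - powerKernel α 0 u) ^ 2
        - (powerKernel α s u - powerKernel α r u) ^ 2) * (1 / 2) := fun u => by ring
  simp only [this]
  have hadd : Integrable fun u => (powerKernel α s u - powerKernel α 0 u) ^ 2 +
      (powerKernel α r u - powerKernel α 0 u) ^ 2 := ms.integrable_sq.add mr.integrable_sq
  rw [integral_mul_const, integral_sub hadd mm.integrable_sq,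
    integral_add ms.integrable_sq mr.integrable_sq, es, er, em, fbmCov,
    show 2 * (α + 1 / 2) = 2 * α + 1 by ring]
  simp only [sub_zero]
  ring

/-- The function `c u ^ p` on `(0,t)`. -/
noncomputable def powerWeight (c p t : ℝ) : ℝ → ℝ :=
  (Set.Ioo 0 t).indicator fun u => c * u ^ p

open Set in
theorem powerWeight_sq {c p t : ℝ} (hp : -(1 / 2) < p) (ht : 0 ≤ t) :
    MemLp (powerWeight c p t) 2 ∧
      ∫ u, powerWeight c p t u ^ 2 = c ^ 2 * (t ^ (2 * p + 1) / (2 * p + 1)) := by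
  have hm : AEStronglyMeasurable (powerWeight c p t) :=
    (Measurable.indicator (by fun_prop) measurableSet_Ioo).aestronglyMeasurable
  have hp' : 0 < 2 * p + 1 := by linarith
  have h : ∫⁻ u, ENNReal.ofReal (powerWeight c p t u ^ 2) =
      ENNReal.ofReal (c ^ 2 * (t ^ (2 * p + 1) / (2 * p + 1))) := by
    rw [ENNReal.ofReal_mul (sq_nonneg c), ← lintegral_Ioo_rpow ht (by linarith),
      ← lintegral_const_mul' _ _ ENNReal.ofReal_ne_top, ← lintegral_indicator measurableSet_Ioo]
    refine lintegral_congr fun u => ?_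
    unfold powerWeight
    by_cases hu : u ∈ Ioo 0 t
    · rw [indicator_of_mem hu, indicator_of_mem hu, ← ENNReal.ofReal_mul (sq_nonneg c), mul_pow,
        mul_comm 2 p, Real.rpow_mul hu.1.le, Real.rpow_two]
    · rw [indicator_of_notMem hu, indicator_of_notMem hu]
      simp
  exact ⟨memLp_two_of_lintegral_sq_lt_top hm (h ▸ ENNReal.ofReal_lt_top),
    integral_sq_eq_of_lintegral hm (by positivity) h⟩

open Set in
-- The kernel at `0` vanishes on `(0,t)`, so only a beta integral over `(0,s)` remains. The exponent
-- `-α` cancels the `α` of the kernel, which makes the result linear in `s`; the constant normalizes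
-- its slope.
theorem integral_powerWeight_mul_mvn {α s t : ℝ} (h1 : -(1 / 2) < α) (h0 : α < 0)
    (hs : s ∈ Icc 0 t) :
    ∫ u, powerWeight (beta (1 - α) (1 + α))⁻¹ (-α) t u
      * (powerKernel α s u - powerKernel α 0 u) = s := by
  have hb := beta_pos (α := 1 - α) (β := 1 + α) (by linarith) (by linarith)
  set b := beta (1 - α) (1 + α) with hbdef
  have e : ∀ u, powerWeight b⁻¹ (-α) t u * (powerKernel α s u - powerKernel α 0 u) =
      (Ioo 0 s).indicator (fun u => b⁻¹ * (u ^ (-α) * (s - u) ^ α)) u := by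
    intro u
    unfold powerWeight powerKernel
    by_cases hu : u ∈ Ioo 0 s
    · rw [indicator_of_mem hu, indicator_of_mem (mem_Ioo.2 ⟨hu.1, hu.2.trans_le hs.2⟩), if_pos hu.2,
        if_neg (not_lt.2 hu.1.le)]
      ring
    · rw [indicator_of_notMem hu]
      by_cases hu2 : u ∈ Ioo 0 t
      · rw [if_neg fun h => hu ⟨hu2.1, h⟩, if_neg (not_lt.2 hu2.1.le)]
        ring
      · rw [indicator_of_notMem hu2, zero_mul]
  simp only [e]
  rw [integral_indicator measurableSet_Ioo]
  rcases hs.1.eq_or_lt with h | hs0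
  · simp [← h]
  rw [integral_const_mul, integral_eq_lintegral_of_nonneg_ae _ (by fun_prop)]
  · have := lintegral_beta_scaled (a := 1 - α) (b := 1 + α) (by linarith) (by linarith) hs0
    rw [show 1 - α - 1 = -α by ring, show 1 + α - 1 = α by ring,
      show 1 - α + (1 + α) - 1 = 1 by ring, Real.rpow_one] at this
    rw [this, ENNReal.toReal_ofReal (by positivity), ← hbdef]
    field_simp
  · refine (ae_restrict_iff' measurableSet_Ioo).2 (Filter.Eventually.of_forall fun u hu => ?_)
    exact mul_nonneg (Real.rpow_nonneg hu.1.le _) (Real.rpow_nonneg (by linarith [hu.2]) _)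

theorem sq_sum_le_fbmCov_of_lt_half {H t : ℝ} (h0 : 0 < H) (h1 : H < 1 / 2) (ht : 0 ≤ t)
    {ι : Type*} (I : Finset ι) (x s : ι → ℝ) (hs : ∀ i ∈ I, s i ∈ Set.Icc 0 t) :
    (∑ i ∈ I, x i * s i) ^ 2 ≤
      ((beta (3 / 2 - H) (H + 1 / 2))⁻¹ ^ 2 * (t ^ (2 - 2 * H) / (2 - 2 * H)))
        * mvnConst (H - 1 / 2) * ∑ i ∈ I, ∑ j ∈ I, x i * x j * fbmCov H (s i) (s j) := by
  have a1 : -(1 / 2) < H - 1 / 2 := by linarith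
  have a0 : H - 1 / 2 < 0 := by linarith
  obtain ⟨hw, hww⟩ := powerWeight_sq (c := (beta (1 - (H - 1 / 2)) (1 + (H - 1 / 2)))⁻¹)
    (p := -(H - 1 / 2)) (by linarith) ht
  have := sq_sum_le_of_features (H := H) (fun s u => powerKernel (H - 1 / 2) s u
      - powerKernel (H - 1 / 2) 0 u) _ (fun s _ => (integral_sq_powerKernel_sub a1 a0 0 s).1) hw
    (fun s _ r _ => by rw [integral_mvn_mul a1 a0, sub_add_cancel])
    (fun s hs => integral_powerWeight_mul_mvn a1 a0 hs) hww I x s hs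
  convert this using 6 <;> ring_nf

/-! ### The Molchan–Golosov kernel; the case `H > 1/2`. -/

open Set in
/-- The integrand of the Molchan–Golosov kernel of fractional Brownian motion, `H > 1/2`. -/
noncomputable def mgKernel (H v u : ℝ) : ℝ :=
  if u ∈ Ioo 0 v then u ^ (1 / 2 - H) * v ^ (H - 1 / 2) * (v - u) ^ (H - 3 / 2) else 0

open Set in
theorem mgKernel_nonneg (H v u : ℝ) : 0 ≤ mgKernel H v u := by
  unfold mgKernel
  split_ifs with h
  · have h1 : 0 < u := h.1
    have h2 : 0 < v - u := by linarith [h.2]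
    have h3 : 0 < v := by linarith
    positivity
  · rfl

theorem measurable_mgKernel (H : ℝ) : Measurable fun p : ℝ × ℝ => mgKernel H p.1 p.2 := by
  unfold mgKernel
  refine Measurable.ite ?_ (by fun_prop) measurable_const
  exact (measurableSet_lt measurable_const measurable_snd).inter
    (measurableSet_lt measurable_snd measurable_fst)

open Set in
-- Inversion turns the overlap into a second-kind beta integral with shift `1/v - 1/v' = (v'-v)/(v
-- v')`. The powers `v^{H-1/2}` in the kernel are there to cancel the leftover powers of `v v'`, so
-- that only `v' - v` survives.
theorem lintegral_mgKernel_mul_of_lt {H v v' : ℝ} (h0 : 1 / 2 < H) (h1 : H < 1) (hv : 0 < v)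
    (hvv : v < v') :
    ∫⁻ u, ENNReal.ofReal (mgKernel H v u * mgKernel H v' u) =
      ENNReal.ofReal (beta (2 - 2 * H) (H - 1 / 2) * (v' - v) ^ (2 * H - 2)) := by
  have hv' : 0 < v' := hv.trans hvv
  have hd : 0 < (v' - v) / (v * v') := div_pos (by linarith) (by positivity)
  have e : ∀ u, ENNReal.ofReal (mgKernel H v u * mgKernel H v' u) =
      (Ioo 0 v).indicator (fun u => ENNReal.ofReal (u ^ (1 - 2 * H) * (v * v') ^ (H - 1 / 2) *
        ((v - u) * (v' - u)) ^ (H - 3 / 2))) u := by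
    intro u
    unfold mgKernel
    by_cases hu : u ∈ Ioo 0 v
    · rw [if_pos hu, if_pos ⟨hu.1, hu.2.trans hvv⟩, indicator_of_mem hu,
        Real.mul_rpow hv.le hv'.le, Real.mul_rpow (by linarith [hu.2]) (by linarith [hu.2]),
        show 1 - 2 * H = (1 / 2 - H) + (1 / 2 - H) by ring, Real.rpow_add hu.1]
      congr 1
      ring
    · rw [if_neg hu, indicator_of_notMem hu]
      simp
  simp only [e]
  rw [lintegral_indicator measurableSet_Ioo, lintegral_Ioo_inversion hv]
  have e2 : ∀ y ∈ Ioi (0 : ℝ), ENNReal.ofReal (v ^ 2 / (1 + v * y) ^ 2) *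
      ENNReal.ofReal ((v / (1 + v * y)) ^ (1 - 2 * H) * (v * v') ^ (H - 1 / 2) *
        ((v - v / (1 + v * y)) * (v' - v / (1 + v * y))) ^ (H - 3 / 2)) =
      ENNReal.ofReal ((v * v') ^ (2 * H - 2)) * ENNReal.ofReal (y ^ (H - 1 / 2 - 1) *
        (y + (v' - v) / (v * v')) ^ (-(2 - 2 * H + (H - 1 / 2)))) := by
    intro y hy
    have hy' : (0 : ℝ) < y := hy
    have hq : 0 < 1 + v * y := by positivity
    rw [← ENNReal.ofReal_mul (by positivity), ← ENNReal.ofReal_mul (by positivity)]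
    congr 1
    have hyd : 0 < y + (v' - v) / (v * v') := by positivity
    have e3 : (v - v / (1 + v * y)) * (v' - v / (1 + v * y)) =
        (v / (1 + v * y)) ^ 2 * ((v * v') * (y * (y + (v' - v) / (v * v')))) := by
      field_simp
      ring
    have hw : 0 < v / (1 + v * y) := by positivity
    rw [e3, ← div_pow, ← Real.rpow_natCast,
      Real.mul_rpow (z := H - 3 / 2) (Real.rpow_nonneg hw.le _) (by positivity),
      Real.mul_rpow (z := H - 3 / 2) (mul_pos hv hv').le (by positivity),
      Real.mul_rpow (z := H - 3 / 2) hy'.le hyd.le,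
      ← Real.rpow_mul hw.le,
      show -(2 - 2 * H + (H - 1 / 2)) = H - 3 / 2 by ring,
      show H - 1 / 2 - 1 = H - 3 / 2 by ring,
      show 2 * H - 2 = (H - 1 / 2) + (H - 3 / 2) by ring, Real.rpow_add (by positivity : 0 < v * v')]
    -- Jacobian and integrand contribute the exponents `2 + (1-2H) + 2(H-3/2) = 0` of `v/(1+vy)`.
    have e4 : (v / (1 + v * y)) ^ ((2 : ℕ) : ℝ) * (v / (1 + v * y)) ^ (1 - 2 * H) *
        (v / (1 + v * y)) ^ (((2 : ℕ) : ℝ) * (H - 3 / 2)) = 1 := by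
      rw [← Real.rpow_add hw, ← Real.rpow_add hw]
      convert Real.rpow_zero _ using 2
      push_cast
      ring
    linear_combination ((v * v') ^ (H - 1 / 2) * (v * v') ^ (H - 3 / 2) * y ^ (H - 3 / 2) *
      (y + (v' - v) / (v * v')) ^ (H - 3 / 2)) * e4
  rw [setLIntegral_congr_fun measurableSet_Ioi e2, lintegral_const_mul' _ _ ENNReal.ofReal_ne_top,
    lintegral_Ioi_beta_scaled (by linarith) (by linarith) hd, ← ENNReal.ofReal_mul (by positivity)]
  congr 1
  have hvv0 : 0 < v * v' := by positivity
  rw [← mul_assoc, show -(2 - 2 * H) = 2 * H - 2 by ring, ← Real.mul_rpow hvv0.le hd.le,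
    mul_div_cancel₀ _ hvv0.ne', mul_comm]

theorem lintegral_mgKernel_mul {H v v' : ℝ} (h0 : 1 / 2 < H) (h1 : H < 1) (hv : 0 < v)
    (hv' : 0 < v') (hne : v ≠ v') :
    ∫⁻ u, ENNReal.ofReal (mgKernel H v u * mgKernel H v' u) =
      ENNReal.ofReal (beta (2 - 2 * H) (H - 1 / 2) * |v - v'| ^ (2 * H - 2)) := by
  rcases hne.lt_or_gt with h | h
  · rw [lintegral_mgKernel_mul_of_lt h0 h1 hv h, abs_sub_comm, abs_of_pos (by linarith)]
  · rw [abs_of_pos (by linarith), ← lintegral_mgKernel_mul_of_lt h0 h1 hv' h]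
    simp only [mul_comm]

open Set in
theorem lintegral_Ioo_reflect (g : ℝ → ENNReal) (a b c : ℝ) :
    ∫⁻ u in Ioo a b, g (c - u) = ∫⁻ x in Ioo (c - b) (c - a), g x := by
  rw [← lintegral_indicator measurableSet_Ioo, ← lintegral_indicator measurableSet_Ioo,
    ← lintegral_sub_left_eq_self ((Ioo (c - b) (c - a)).indicator fun x => g x) c]
  refine lintegral_congr fun u => ?_
  by_cases hu : u ∈ Ioo a b
  · rw [indicator_of_mem hu,
      indicator_of_mem (mem_Ioo.2 ⟨by linarith [hu.2], by linarith [hu.1]⟩)]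
  · rw [indicator_of_notMem hu, indicator_of_notMem]
    exact fun h => hu ⟨by linarith [h.2], by linarith [h.1]⟩

open Set in
theorem lintegral_Ioo_shift (g : ℝ → ENNReal) (a b c : ℝ) :
    ∫⁻ u in Ioo a b, g (u - c) = ∫⁻ x in Ioo (a - c) (b - c), g x := by
  have h1 := lintegral_Ioo_reflect (fun u => g (-u)) a b c
  have h2 := lintegral_Ioo_reflect g (c - b) (c - a) 0
  simp only [neg_sub, zero_sub] at h1 h2
  rw [h1, h2]

open Set in
theorem lintegral_abs_sub_rpow {s c p : ℝ} (hp : -1 < p) (hc : c ∈ Icc 0 s) :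
    ∫⁻ v in Ioo 0 s, ENNReal.ofReal (|v - c| ^ p) =
      ENNReal.ofReal ((c ^ (p + 1) + (s - c) ^ (p + 1)) / (p + 1)) := by
  have hp' : 0 < p + 1 := by linarith
  have hsc : 0 ≤ s - c := sub_nonneg.2 hc.2
  have hl : ∫⁻ v in Ioo 0 c, ENNReal.ofReal (|v - c| ^ p) =
      ENNReal.ofReal (c ^ (p + 1) / (p + 1)) := by
    have := lintegral_Ioo_reflect (fun x => ENNReal.ofReal (x ^ p)) 0 c c
    rw [sub_self, sub_zero, lintegral_Ioo_rpow hc.1 hp] at this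
    rw [← this]
    refine setLIntegral_congr_fun measurableSet_Ioo fun v hv => ?_
    rw [abs_sub_comm, abs_of_pos (by linarith [hv.2])]
  have hr : ∫⁻ v in Ioo c s, ENNReal.ofReal (|v - c| ^ p) =
      ENNReal.ofReal ((s - c) ^ (p + 1) / (p + 1)) := by
    have := lintegral_Ioo_shift (fun x => ENNReal.ofReal (x ^ p)) c s c
    rw [sub_self, lintegral_Ioo_rpow hsc hp] at this
    rw [← this]
    refine setLIntegral_congr_fun measurableSet_Ioo fun v hv => ?_
    rw [abs_of_pos (by linarith [hv.1])]
  have hc0 := hc.1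
  rw [add_div, ENNReal.ofReal_add (by positivity) (by positivity), ← hl, ← hr,
    restrict_Ioo_eq_restrict_Ioc, restrict_Ioo_eq_restrict_Ioc, restrict_Ioo_eq_restrict_Ioc,
    ← Ioc_union_Ioc_eq_Ioc hc.1 hc.2,
    lintegral_union measurableSet_Ioc (Ioc_disjoint_Ioc_of_le le_rfl)]

open Set in
-- For `H > 1/2`, `H(2H-1)|v-c|^{2H-2}` is the mixed second derivative of the fractional Brownian
-- covariance, which vanishes on the axes.
theorem lintegral_lintegral_abs_sub_rpow {H s r : ℝ} (h0 : 1 / 2 < H) (hr : 0 ≤ r) (hrs : r ≤ s) :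
    ∫⁻ c in Ioo 0 r, ∫⁻ v in Ioo 0 s, ENNReal.ofReal (|v - c| ^ (2 * H - 2)) =
      ENNReal.ofReal (fbmCov H s r / (H * (2 * H - 1))) := by
  have hs : 0 ≤ s := hr.trans hrs
  have h2 : 0 < 2 * H - 1 := by linarith
  have e : ∀ c ∈ Ioo 0 r, ∫⁻ v in Ioo 0 s, ENNReal.ofReal (|v - c| ^ (2 * H - 2)) =
      ENNReal.ofReal (1 / (2 * H - 1)) * (ENNReal.ofReal (c ^ (2 * H - 1)) +
        ENNReal.ofReal ((s - c) ^ (2 * H - 1))) := by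
    intro c hc
    have hc0 : 0 < c := hc.1
    have hsc : 0 ≤ s - c := by linarith [hc.2]
    rw [lintegral_abs_sub_rpow (by linarith) ⟨hc0.le, hc.2.le.trans hrs⟩,
      ← ENNReal.ofReal_add (by positivity) (by positivity), ← ENNReal.ofReal_mul (by positivity),
      show 2 * H - 2 + 1 = 2 * H - 1 by ring]
    congr 1
    ring
  have h3 : ∫⁻ c in Ioo 0 r, ENNReal.ofReal ((s - c) ^ (2 * H - 1)) =
      ENNReal.ofReal ((s ^ (2 * H) - (s - r) ^ (2 * H)) / (2 * H)) := by
    rw [lintegral_Ioo_reflect (fun x => ENNReal.ofReal (x ^ (2 * H - 1))),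
      restrict_Ioo_eq_restrict_Ioc, ← ofReal_integral_eq_lintegral_ofReal,
      ← intervalIntegral.integral_of_le (by linarith), integral_rpow (Or.inl (by linarith))]
    · rw [sub_zero, sub_add_cancel]
    · exact (intervalIntegrable_iff_integrableOn_Ioc_of_le (by linarith)).1
        (intervalIntegral.intervalIntegrable_rpow' (by linarith))
    · refine (ae_restrict_iff' measurableSet_Ioc).2 (Filter.Eventually.of_forall fun x hx => ?_)
      exact Real.rpow_nonneg (by linarith [hx.1]) _
  have hmono : (s - r) ^ (2 * H) ≤ s ^ (2 * H) :=
    Real.rpow_le_rpow (by linarith) (by linarith) (by linarith)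
  rw [setLIntegral_congr_fun measurableSet_Ioo e, lintegral_const_mul' _ _ ENNReal.ofReal_ne_top,
    lintegral_add_left (by fun_prop), h3, lintegral_Ioo_rpow hr (by linarith), sub_add_cancel,
    ← ENNReal.ofReal_add (by positivity) (div_nonneg (by linarith) (by linarith)),
    ← ENNReal.ofReal_mul (by positivity)]
  congr 1
  rw [fbmCov, abs_of_nonneg hr, abs_of_nonneg hs, abs_of_nonneg (by linarith : 0 ≤ s - r)]
  have : H ≠ 0 := by linarith
  field_simp
  ring

theorem fbmCov_comm (H s r : ℝ) : fbmCov H s r = fbmCov H r s := by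
  rw [fbmCov, fbmCov, abs_sub_comm]
  ring

open Set in
/-- The Molchan–Golosov kernel. -/
noncomputable def mgIntegral (H s u : ℝ) : ENNReal :=
  ∫⁻ v in Ioo 0 s, ENNReal.ofReal (mgKernel H v u)

theorem measurable_mgIntegral (H s : ℝ) : Measurable (mgIntegral H s) := by
  have h : Measurable fun p : ℝ × ℝ => ENNReal.ofReal (mgKernel H p.2 p.1) :=
    ((measurable_mgKernel H).comp measurable_swap).ennreal_ofReal
  exact h.lintegral_prod_right'

open Set in
theorem lintegral_mgIntegral_mul {H s r : ℝ} (h0 : 1 / 2 < H) (h1 : H < 1) (hr : 0 ≤ r)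
    (hrs : r ≤ s) :
    ∫⁻ u, mgIntegral H r u * mgIntegral H s u =
      ENNReal.ofReal (beta (2 - 2 * H) (H - 1 / 2) / (H * (2 * H - 1)) * fbmCov H s r) := by
  have hb := beta_pos (α := 2 - 2 * H) (β := H - 1 / 2) (by linarith) (by linarith)
  have hm := measurable_mgKernel H
  have hm1 : ∀ v, Measurable fun u => mgKernel H v u := fun v => hm.of_uncurry_left
  have hm2 : ∀ u, Measurable fun v => mgKernel H v u := fun u => hm.of_uncurry_right
  have e1 : ∀ u, mgIntegral H r u * mgIntegral H s u =
      ∫⁻ c in Ioo 0 r, ENNReal.ofReal (mgKernel H c u) * mgIntegral H s u := fun u =>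
    (lintegral_mul_const _ (hm2 u).ennreal_ofReal).symm
  have e2 : ∀ c, ∫⁻ u, ENNReal.ofReal (mgKernel H c u) * mgIntegral H s u =
      ∫⁻ v in Ioo 0 s, ∫⁻ u, ENNReal.ofReal (mgKernel H c u * mgKernel H v u) := by
    intro c
    rw [lintegral_lintegral_swap]
    · refine lintegral_congr fun u => ?_
      rw [mgIntegral, ← lintegral_const_mul _ (hm2 u).ennreal_ofReal]
      exact lintegral_congr fun v => (ENNReal.ofReal_mul (mgKernel_nonneg _ _ _)).symm
    · exact (((hm1 c).comp measurable_snd).mul hm).ennreal_ofReal.aemeasurable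
  simp only [e1]
  rw [lintegral_lintegral_swap]
  · simp only [e2]
    rw [div_mul_eq_mul_div, mul_div_assoc, ENNReal.ofReal_mul hb.le,
      ← lintegral_lintegral_abs_sub_rpow h0 hr hrs,
      ← lintegral_const_mul' _ _ ENNReal.ofReal_ne_top]
    refine setLIntegral_congr_fun measurableSet_Ioo fun c hc => ?_
    rw [← lintegral_const_mul' _ _ ENNReal.ofReal_ne_top]
    -- The overlap formula fails on the diagonal, where the kernel is not square integrable and `0`
    -- to a negative power is `0` by convention.
    have hae : ∀ᵐ v : ℝ, v ≠ c := by simp [ae_iff]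
    refine setLIntegral_congr_fun_ae measurableSet_Ioo ?_
    filter_upwards [hae] with v hv hv2
    rw [lintegral_mgKernel_mul h0 h1 hc.1 hv2.1 hv.symm, ENNReal.ofReal_mul hb.le, abs_sub_comm]
  · exact ((hm.comp measurable_swap).ennreal_ofReal.mul
      ((measurable_mgIntegral H s).comp measurable_fst)).aemeasurable

open Set in
theorem memLp_mgIntegral {H s : ℝ} (h0 : 1 / 2 < H) (h1 : H < 1) (hs : 0 ≤ s) :
    MemLp (fun u => (mgIntegral H s u).toReal) 2 ∧ ∀ᵐ u, mgIntegral H s u < ⊤ := by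
  have h := lintegral_mgIntegral_mul h0 h1 hs le_rfl
  have hfin : ∀ᵐ u, mgIntegral H s u < ⊤ := by
    have hm := measurable_mgIntegral H s
    filter_upwards [ae_lt_top (hm.mul hm) (h ▸ ENNReal.ofReal_ne_top)] with u hu
    by_contra hcon
    simp [not_lt_top_iff.1 hcon] at hu
  refine ⟨memLp_two_of_lintegral_sq_lt_top
    (measurable_mgIntegral H s).ennreal_toReal.aestronglyMeasurable ?_, hfin⟩
  refine lt_of_le_of_lt (le_of_eq ?_) (h ▸ ENNReal.ofReal_lt_top :
    ∫⁻ u, mgIntegral H s u * mgIntegral H s u < ⊤)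
  refine lintegral_congr_ae ?_
  filter_upwards [hfin] with u hu
  rw [sq, ENNReal.ofReal_mul ENNReal.toReal_nonneg, ENNReal.ofReal_toReal hu.ne]

open Set in
theorem integral_mgIntegral_mul {H s r : ℝ} (h0 : 1 / 2 < H) (h1 : H < 1) (hs : 0 ≤ s)
    (hr : 0 ≤ r) :
    ∫ u, (mgIntegral H s u).toReal * (mgIntegral H r u).toReal =
      beta (2 - 2 * H) (H - 1 / 2) / (H * (2 * H - 1)) * fbmCov H s r := by
  wlog hrs : r ≤ s generalizing s r with hw
  · simp only [mul_comm (mgIntegral H s _).toReal]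
    rw [hw hr hs (le_of_not_ge hrs), fbmCov_comm]
  have hb := beta_pos (α := 2 - 2 * H) (β := H - 1 / 2) (by linarith) (by linarith)
  have h2 : 0 < 2 * H - 1 := by linarith
  have hcov : 0 ≤ fbmCov H s r := by
    have := Real.rpow_le_rpow (z := 2 * H) (by linarith : 0 ≤ s - r) (by linarith : s - r ≤ s)
      (by linarith)
    have := Real.rpow_nonneg hr (2 * H)
    rw [fbmCov, abs_of_nonneg hr, abs_of_nonneg hs, abs_of_nonneg (by linarith : 0 ≤ s - r)]
    linarith
  simp only [← ENNReal.toReal_mul]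
  rw [integral_toReal]
  · simp only [mul_comm (mgIntegral H s _)]
    rw [lintegral_mgIntegral_mul h0 h1 hr hrs, ENNReal.toReal_ofReal]
    have : 0 < H := by linarith
    positivity
  · exact ((measurable_mgIntegral H s).mul (measurable_mgIntegral H r)).aemeasurable
  · filter_upwards [(memLp_mgIntegral h0 h1 hs).2, (memLp_mgIntegral h0 h1 hr).2] with u hu1 hu2
    exact ENNReal.mul_lt_top hu1 hu2

open Set in
theorem integral_powerWeight_mul_mgIntegral {H s t : ℝ} (h0 : 1 / 2 < H) (h1 : H < 1)
    (hs : s ∈ Icc 0 t) :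
    ∫ u, powerWeight (beta (2 - 2 * H) (H - 1 / 2))⁻¹ (1 / 2 - H) t u
      * (mgIntegral H s u).toReal = s := by
  have hb := beta_pos (α := 2 - 2 * H) (β := H - 1 / 2) (by linarith) (by linarith)
  set b := beta (2 - 2 * H) (H - 1 / 2) with hbdef
  have hm := measurable_mgKernel H
  have hm2 : ∀ u, Measurable fun v => mgKernel H v u := fun u => hm.of_uncurry_right
  have hwm : Measurable (powerWeight b⁻¹ (1 / 2 - H) t) :=
    Measurable.indicator (by fun_prop) measurableSet_Ioo
  have hw0 : ∀ u, 0 ≤ powerWeight b⁻¹ (1 / 2 - H) t u := fun u =>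
    indicator_nonneg (fun u hu => mul_nonneg (inv_nonneg.2 hb.le) (Real.rpow_nonneg hu.1.le _)) u
  have key : ∫⁻ u, ENNReal.ofReal (powerWeight b⁻¹ (1 / 2 - H) t u) * mgIntegral H s u =
      ENNReal.ofReal s := by
    have e1 : ∀ u, ENNReal.ofReal (powerWeight b⁻¹ (1 / 2 - H) t u) * mgIntegral H s u =
        ∫⁻ v in Ioo 0 s, ENNReal.ofReal (powerWeight b⁻¹ (1 / 2 - H) t u * mgKernel H v u) := by
      intro u
      rw [mgIntegral, ← lintegral_const_mul _ (hm2 u).ennreal_ofReal]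
      exact lintegral_congr fun v => (ENNReal.ofReal_mul (hw0 u)).symm
    simp only [e1]
    rw [lintegral_lintegral_swap]
    -- The weight is chosen so that its pairing with the kernel at each `v` is exactly `1`;
    -- integrating over `v` in `(0,s)` then gives `s`.
    · have e2 : ∀ v ∈ Ioo 0 s,
          ∫⁻ u, ENNReal.ofReal (powerWeight b⁻¹ (1 / 2 - H) t u * mgKernel H v u) = 1 := by
        intro v hv
        have h := lintegral_beta_scaled (a := 2 - 2 * H) (b := H - 1 / 2) (by linarith)
          (by linarith) hv.1
        have e3 : ∀ u, ENNReal.ofReal (powerWeight b⁻¹ (1 / 2 - H) t u * mgKernel H v u) =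
            (Ioo 0 v).indicator (fun u => ENNReal.ofReal (b⁻¹ * v ^ (H - 1 / 2)) *
              ENNReal.ofReal (u ^ (2 - 2 * H - 1) * (v - u) ^ (H - 1 / 2 - 1))) u := by
          intro u
          unfold powerWeight mgKernel
          by_cases hu : u ∈ Ioo 0 v
          · have hv0 := hv.1
            rw [if_pos hu, indicator_of_mem (mem_Ioo.2 ⟨hu.1, (hu.2.trans hv.2).trans_le hs.2⟩),
              indicator_of_mem hu, ← ENNReal.ofReal_mul (by positivity),
              show 2 - 2 * H - 1 = (1 / 2 - H) + (1 / 2 - H) by ring, Real.rpow_add hu.1,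
              show H - 1 / 2 - 1 = H - 3 / 2 by ring]
            congr 1
            ring
          · rw [if_neg hu, indicator_of_notMem hu, mul_zero, ENNReal.ofReal_zero]
        simp only [e3]
        have hv0 := hv.1
        rw [lintegral_indicator measurableSet_Ioo, lintegral_const_mul' _ _ ENNReal.ofReal_ne_top,
          h, ← ENNReal.ofReal_mul (by positivity), ← hbdef, ← ENNReal.ofReal_one]
        congr 1
        have : v ^ (H - 1 / 2) * v ^ (2 - 2 * H + (H - 1 / 2) - 1) = 1 := by
          rw [← Real.rpow_add hv0]
          convert Real.rpow_zero v using 2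
          ring
        have hbb : b⁻¹ * b = 1 := inv_mul_cancel₀ hb.ne'
        linear_combination b⁻¹ * b * this + hbb
      rw [setLIntegral_congr_fun measurableSet_Ioo e2]
      simp
    · exact ((hwm.comp measurable_fst).mul (hm.comp measurable_swap)).ennreal_ofReal.aemeasurable
  have e : ∀ u, powerWeight b⁻¹ (1 / 2 - H) t u * (mgIntegral H s u).toReal =
      (ENNReal.ofReal (powerWeight b⁻¹ (1 / 2 - H) t u) * mgIntegral H s u).toReal := by
    intro u
    rw [ENNReal.toReal_mul, ENNReal.toReal_ofReal (hw0 u)]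
  simp only [e]
  rw [integral_toReal, key, ENNReal.toReal_ofReal hs.1]
  · exact (hwm.ennreal_ofReal.mul (measurable_mgIntegral H s)).aemeasurable
  · filter_upwards [(memLp_mgIntegral h0 h1 hs.1).2] with u hu
    exact ENNReal.mul_lt_top ENNReal.ofReal_lt_top hu

theorem sq_sum_le_fbmCov_of_half_lt {H t : ℝ} (h0 : 1 / 2 < H) (h1 : H < 1) (ht : 0 ≤ t)
    {ι : Type*} (I : Finset ι) (x s : ι → ℝ) (hs : ∀ i ∈ I, s i ∈ Set.Icc 0 t) :
    (∑ i ∈ I, x i * s i) ^ 2 ≤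
      ((beta (2 - 2 * H) (H - 1 / 2))⁻¹ ^ 2 * (t ^ (2 - 2 * H) / (2 - 2 * H)))
        * (beta (2 - 2 * H) (H - 1 / 2) / (H * (2 * H - 1)))
        * ∑ i ∈ I, ∑ j ∈ I, x i * x j * fbmCov H (s i) (s j) := by
  obtain ⟨hw, hww⟩ := powerWeight_sq (c := (beta (2 - 2 * H) (H - 1 / 2))⁻¹)
    (p := 1 / 2 - H) (by linarith) ht
  rw [show 2 * (1 / 2 - H) + 1 = 2 - 2 * H by ring] at hww
  exact sq_sum_le_of_features (H := H) _ _
    (fun s hs => (memLp_mgIntegral h0 h1 hs.1).1) hw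
    (fun s hs r hr => integral_mgIntegral_mul h0 h1 hs.1 hr.1)
    (fun s hs => integral_powerWeight_mul_mgIntegral h0 h1 hs) hww I x s hs

/-! ### Comparison of constants. -/

/-- The duplication formula replaces `Γ(2x)` by `Γ(x) Γ(x+1/2)`, and log-convexity at the midpoint
`x+1` of `x+1/2` and `x+3/2` controls `Γ(x)` by `Γ(x+1/2)`. What remains is an elementary
inequality. It is applied at `x = 1 - H`. -/
theorem Gamma_two_mul_sq_le {x : ℝ} (h0 : 1 / 2 ≤ x) (h1 : x ≤ 1) :
    Real.Gamma (2 * x) ^ 2 ≤ 2 * Real.Gamma (x + 1 / 2) ^ 4 := by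
  have hx : 0 < x := by linarith
  have g1 : 0 < Real.Gamma x := Real.Gamma_pos_of_pos hx
  have g2 : 0 < Real.Gamma (x + 1 / 2) := Real.Gamma_pos_of_pos (by linarith)
  have hlog : (x * Real.Gamma x) ^ 2 ≤ (x + 1 / 2) * Real.Gamma (x + 1 / 2) ^ 2 := by
    have h := Real.Gamma_mul_add_mul_le_rpow_Gamma_mul_rpow_Gamma (s := x + 1 / 2)
      (t := x + 1 / 2 + 1) (a := 1 / 2) (b := 1 / 2) (by linarith) (by linarith) (by norm_num)
      (by norm_num) (by norm_num)
    rw [show 1 / 2 * (x + 1 / 2) + 1 / 2 * (x + 1 / 2 + 1) = x + 1 by ring,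
      Real.Gamma_add_one hx.ne', Real.Gamma_add_one (by linarith : x + 1 / 2 ≠ 0),
      ← Real.sqrt_eq_rpow, ← Real.sqrt_eq_rpow, ← Real.sqrt_mul g2.le] at h
    have h2 := pow_le_pow_left₀ (by positivity) h 2
    rw [Real.sq_sqrt (by positivity)] at h2
    linarith
  -- Bernoulli's inequality for an exponent in `[0,1]`, that is, the chord of a convex function.
  have hpow : (4 : ℝ) ^ (2 * x - 1) ≤ 1 + 3 * (2 * x - 1) := by
    have := rpow_one_add_le_one_add_mul_self (s := 3) (p := 2 * x - 1) (by norm_num)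
      (by linarith) (by linarith)
    rw [show (1 : ℝ) + 3 = 4 by norm_num] at this
    linarith
  have hdup := Real.Gamma_mul_Gamma_add_half x
  have e2 : (2 : ℝ) ^ (1 - 2 * x) * (2 : ℝ) ^ (2 * x - 1) = 1 := by
    rw [← Real.rpow_add two_pos]
    simp
  have e4 : ((2 : ℝ) ^ (2 * x - 1)) ^ 2 = 4 ^ (2 * x - 1) := by
    rw [← Real.rpow_natCast, ← Real.rpow_mul two_pos.le, mul_comm, Real.rpow_mul two_pos.le]
    norm_num
  have hpi := Real.pi_gt_d2
  have hsq : √Real.pi ^ 2 = Real.pi := Real.sq_sqrt Real.pi_pos.le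
  have hG : Real.Gamma (2 * x) ^ 2 * Real.pi =
      Real.Gamma x ^ 2 * Real.Gamma (x + 1 / 2) ^ 2 * 4 ^ (2 * x - 1) := by
    rw [← hsq, ← e4]
    have : Real.Gamma (2 * x) * √Real.pi =
        Real.Gamma x * Real.Gamma (x + 1 / 2) * 2 ^ (2 * x - 1) := by
      rw [hdup]
      linear_combination -(Real.Gamma (2 * x) * √Real.pi) * e2
    rw [← mul_pow, this]
    ring
  have hmain : Real.Gamma x ^ 2 * 4 ^ (2 * x - 1) ≤ 2 * Real.pi * Real.Gamma (x + 1 / 2) ^ 2 := by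
    have h3 : 4 ^ (2 * x - 1) * (x + 1 / 2) ≤ 2 * Real.pi * x ^ 2 := by
      calc _ ≤ (1 + 3 * (2 * x - 1)) * (x + 1 / 2) := by gcongr
        -- The claim is `(2π-6) x² - x + 1 ≥ 0`. With `2π - 6 > 0.28` the discriminant is negative;
        -- the quadratic with coefficient `0.28` has its minimum near `7/4`.
        _ ≤ 2 * Real.pi * x ^ 2 := by nlinarith [sq_nonneg (x - 7 / 4), sq_nonneg x]
    have h4 : (0 : ℝ) < 4 ^ (2 * x - 1) := by positivity
    have h5 : x ^ 2 * (Real.Gamma x ^ 2 * 4 ^ (2 * x - 1)) ≤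
        x ^ 2 * (2 * Real.pi * Real.Gamma (x + 1 / 2) ^ 2) := by
      calc _ = (x * Real.Gamma x) ^ 2 * 4 ^ (2 * x - 1) := by ring
        _ ≤ ((x + 1 / 2) * Real.Gamma (x + 1 / 2) ^ 2) * 4 ^ (2 * x - 1) := by gcongr
        _ = (4 ^ (2 * x - 1) * (x + 1 / 2)) * Real.Gamma (x + 1 / 2) ^ 2 := by ring
        _ ≤ (2 * Real.pi * x ^ 2) * Real.Gamma (x + 1 / 2) ^ 2 := by gcongr
        _ = _ := by ring
    exact le_of_mul_le_mul_left h5 (by positivity)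
  have h6 : Real.Gamma (2 * x) ^ 2 * Real.pi ≤ 2 * Real.Gamma (x + 1 / 2) ^ 4 * Real.pi := by
    rw [hG]
    nlinarith [mul_le_mul_of_nonneg_right hmain (sq_nonneg (Real.Gamma (x + 1 / 2)))]
  exact le_of_mul_le_mul_right h6 Real.pi_pos

theorem cM_nonneg {H : ℝ} (hH : H ∈ Set.Ioo (0 : ℝ) 1) : 0 ≤ cM H := by
  have h0 := hH.1
  have h1 := hH.2
  have g1 : 0 < Real.Gamma (3 / 2 - H) := Real.Gamma_pos_of_pos (by linarith)
  have g2 : 0 < Real.Gamma (H + 1 / 2) := Real.Gamma_pos_of_pos (by linarith)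
  have g3 : 0 < Real.Gamma (3 - 2 * H) := Real.Gamma_pos_of_pos (by linarith)
  unfold cM
  positivity

theorem Gamma_three_sub {H : ℝ} (h1 : H < 1) :
    Real.Gamma (3 - 2 * H) = (2 - 2 * H) * Real.Gamma (2 - 2 * H) := by
  rw [← Real.Gamma_add_one (by linarith : 2 - 2 * H ≠ 0)]
  congr 1
  ring

/-- For `H > 1/2` the feature bound gives `c_M` itself. For `H < 1/2` it gives `c_M Γ(2-2H)² /
Γ(3/2-H)⁴`, and the factor 2 absorbs the ratio. -/
theorem aConst_sq_mul_sq_sum_le {H t : ℝ} (hH : H ∈ Set.Ioo (0 : ℝ) 1) (hne : H ≠ 1 / 2)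
    (ht : 0 ≤ t) {ι : Type*} (I : Finset ι) (x s : ι → ℝ) (hs : ∀ i ∈ I, s i ∈ Set.Icc 0 t)
    (hpos : 0 ≤ ∑ i ∈ I, ∑ j ∈ I, x i * x j * fbmCov H (s i) (s j)) :
    (aConst H * ∑ i ∈ I, x i * s i) ^ 2 ≤ 2 * cM H * t ^ (2 - 2 * H) *
      ∑ i ∈ I, ∑ j ∈ I, x i * x j * fbmCov H (s i) (s j) := by
  obtain ⟨h0, h1⟩ := hH
  have htp : 0 ≤ t ^ (2 - 2 * H) := Real.rpow_nonneg ht _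
  have g1 : 0 < Real.Gamma (3 / 2 - H) := Real.Gamma_pos_of_pos (by linarith)
  have g2 : 0 < Real.Gamma (H + 1 / 2) := Real.Gamma_pos_of_pos (by linarith)
  have g3 : 0 < Real.Gamma (2 - 2 * H) := Real.Gamma_pos_of_pos (by linarith)
  have k1 : 0 < 2 - 2 * H := by linarith
  rw [mul_pow]
  rcases hne.lt_or_gt with hlt | hgt
  · refine (mul_le_mul_of_nonneg_left (sq_sum_le_fbmCov_of_lt_half h0 hlt ht I x s hs)
      (sq_nonneg (aConst H))).trans ?_
    rw [← mul_assoc]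
    refine mul_le_mul_of_nonneg_right ?_ hpos
    have g4 : (1 - 2 * H) * Real.Gamma (1 - 2 * H) = Real.Gamma (2 - 2 * H) := by
      rw [← Real.Gamma_add_one (by linarith : 1 - 2 * H ≠ 0)]
      congr 1
      ring
    have hmvn : mvnConst (H - 1 / 2) = Real.Gamma (2 - 2 * H) * Real.Gamma (H + 1 / 2) /
        (2 * H * Real.Gamma (3 / 2 - H)) := by
      rw [mvnConst, beta, ← g4, show -2 * (H - 1 / 2) = 1 - 2 * H by ring,
        show 1 + (H - 1 / 2) = H + 1 / 2 by ring,
        show 1 - 2 * H + (H + 1 / 2) = 3 / 2 - H by ring,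
        show 2 * (H - 1 / 2) + 1 = 2 * H by ring]
      field_simp
      ring
    have hgam := Gamma_two_mul_sq_le (x := 1 - H) (by linarith) (by linarith)
    rw [show 2 * (1 - H) = 2 - 2 * H by ring, show 1 - H + 1 / 2 = 3 / 2 - H by ring] at hgam
    rw [hmvn, cM, Gamma_three_sub h1, beta, show 3 / 2 - H + (H + 1 / 2) = 2 by ring,
      Real.Gamma_two, inv_div, div_pow, one_pow]
    set p := Real.Gamma (3 / 2 - H)
    set q := Real.Gamma (H + 1 / 2)
    set m := Real.Gamma (2 - 2 * H)
    have e1 : aConst H ^ 2 * (1 / (p * q) ^ 2 * (t ^ (2 - 2 * H) / (2 - 2 * H)) *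
        (m * q / (2 * H * p))) =
        (aConst H ^ 2 * t ^ (2 - 2 * H) / (2 * H * (2 - 2 * H) * q * m * p ^ 3)) * m ^ 2 := by
      field_simp
    have e2 : 2 * (aConst H ^ 2 * p / (2 * H * q * ((2 - 2 * H) * m))) * t ^ (2 - 2 * H) =
        (aConst H ^ 2 * t ^ (2 - 2 * H) / (2 * H * (2 - 2 * H) * q * m * p ^ 3)) * (2 * p ^ 4) := by
      field_simp
    rw [e1, e2]
    exact mul_le_mul_of_nonneg_left hgam (by positivity)
  · refine (mul_le_mul_of_nonneg_left (sq_sum_le_fbmCov_of_half_lt hgt h1 ht I x s hs)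
      (sq_nonneg (aConst H))).trans ?_
    rw [← mul_assoc]
    refine mul_le_mul_of_nonneg_right ?_ hpos
    have g5 : 0 < Real.Gamma (H - 1 / 2) := Real.Gamma_pos_of_pos (by linarith)
    have g6 : Real.Gamma (H + 1 / 2) = (H - 1 / 2) * Real.Gamma (H - 1 / 2) := by
      rw [← Real.Gamma_add_one (by linarith : H - 1 / 2 ≠ 0)]
      congr 1
      ring
    have k2 : 0 < H - 1 / 2 := by linarith
    have k3 : 2 * H - 1 = 2 * (H - 1 / 2) := by ring
    rw [cM, Gamma_three_sub h1, g6, beta, show 2 - 2 * H + (H - 1 / 2) = 3 / 2 - H by ring, k3]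
    set p := Real.Gamma (3 / 2 - H)
    set q := Real.Gamma (H - 1 / 2)
    set m := Real.Gamma (2 - 2 * H)
    have e1 : aConst H ^ 2 * ((m * q / p)⁻¹ ^ 2 * (t ^ (2 - 2 * H) / (2 - 2 * H)) *
        (m * q / p / (H * (2 * (H - 1 / 2))))) =
        aConst H ^ 2 * p / (2 * H * ((H - 1 / 2) * q) * ((2 - 2 * H) * m)) * t ^ (2 - 2 * H) := by
      field_simp
    rw [e1]
    have e2 : 0 ≤ aConst H ^ 2 * p / (2 * H * ((H - 1 / 2) * q) * ((2 - 2 * H) * m)) *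
        t ^ (2 - 2 * H) := by positivity
    linarith

/-- This is the reflection formula for `Γ(2H+1) Γ(-2H)`; `H ≠ 1/2` keeps `cos (πH)` away from zero,
so it can be cancelled. -/
theorem fieldConst_self {H : ℝ} (hH : H ∈ Set.Ioo (0 : ℝ) 1) (hne : H ≠ 1 / 2) :
    fieldConst H H = 1 := by
  obtain ⟨h0, h1⟩ := hH
  have hsin : 0 < Real.sin (Real.pi * H) :=
    Real.sin_pos_of_pos_of_lt_pi (by positivity) (by nlinarith [Real.pi_pos])
  have hG : 0 < Real.Gamma (2 * H + 1) := Real.Gamma_pos_of_pos (by linarith)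
  have hcos : Real.cos (Real.pi * H) ≠ 0 := by
    rcases hne.lt_or_gt with h | h
    · exact (Real.cos_pos_of_mem_Ioo ⟨by nlinarith [Real.pi_pos], by nlinarith [Real.pi_pos]⟩).ne'
    · exact (Real.cos_neg_of_pi_div_two_lt_of_lt (by nlinarith [Real.pi_pos])
        (by nlinarith [Real.pi_pos])).ne
  have hrefl := Real.Gamma_mul_Gamma_one_sub (2 * H + 1)
  rw [show 1 - (2 * H + 1) = -(H + H) by ring,
    show Real.pi * (2 * H + 1) = 2 * (Real.pi * H) + Real.pi by ring, Real.sin_add_pi,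
    Real.sin_two_mul] at hrefl
  rw [fieldConst, if_neg (fun h => hne (by linarith)), sub_self, zero_mul, Real.cos_zero,
    show (H + H) * (Real.pi / 2) = Real.pi * H by ring]
  calc _ = -(2 / Real.pi) * (√(Real.Gamma (2 * H + 1) * Real.sin (Real.pi * H)) ^ 2)
        * Real.Gamma (-(H + H)) * Real.cos (Real.pi * H) := by ring
    _ = -(2 / Real.pi) * Real.sin (Real.pi * H) * Real.cos (Real.pi * H) *
        (Real.Gamma (2 * H + 1) * Real.Gamma (-(H + H))) := by
          rw [Real.sq_sqrt (by positivity)]; ring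
    _ = 1 := by
          rw [hrefl]
          have := Real.pi_pos.ne'
          field_simp

theorem fieldConst_one_sub (H : ℝ) : fieldConst H (1 - H) = aConst H := by
  rw [fieldConst, if_pos (by ring)]

/-! ### Gaussian subspaces of `L²` and conditional expectation. -/

section

variable {Ω : Type*} [MeasurableSpace Ω] {P : Measure Ω}

/-- The map is Lipschitz with constant `|t|`, because `|e^{ix} - 1| ≤ |x|` and the `L¹` norm is at
most the `L²` norm on a probability space. -/
theorem continuous_integral_exp_mul_I (P : Measure Ω) [IsProbabilityMeasure P] (t : ℝ) :
    Continuous fun f : Lp ℝ 2 P => ∫ ω, Complex.exp (t * f ω * Complex.I) ∂P := by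
  have hint : ∀ f : Lp ℝ 2 P, Integrable (fun ω => Complex.exp (t * f ω * Complex.I)) P := by
    intro f
    refine Integrable.of_bound (C := 1) ?_ (Filter.Eventually.of_forall fun ω => ?_)
    · have := (Lp.stronglyMeasurable f).measurable
      exact Measurable.aestronglyMeasurable (by fun_prop)
    · rw [← Complex.ofReal_mul, Complex.norm_exp_ofReal_mul_I]
  refine (LipschitzWith.of_dist_le_mul (K := ⟨|t|, abs_nonneg t⟩) fun f g => ?_).continuous
  rw [dist_eq_norm, dist_eq_norm, ← integral_sub (hint f) (hint g)]
  have hfg : MemLp (fun ω => f ω - g ω) 2 P := (Lp.memLp f).sub (Lp.memLp g)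
  calc ‖∫ ω, Complex.exp (t * f ω * Complex.I) - Complex.exp (t * g ω * Complex.I) ∂P‖
      ≤ ∫ ω, |t| * ‖f ω - g ω‖ ∂P := by
        refine norm_integral_le_of_norm_le
          ((hfg.integrable one_le_two).norm.const_mul _) (Filter.Eventually.of_forall fun ω => ?_)
        have e : Complex.exp (t * f ω * Complex.I) - Complex.exp (t * g ω * Complex.I) =
            Complex.exp ((t * g ω : ℝ) * Complex.I) *
              (Complex.exp (Complex.I * (t * (f ω - g ω) : ℝ)) - 1) := by
          rw [mul_sub, mul_one, ← Complex.exp_add]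
          push_cast
          ring_nf
        rw [e, norm_mul, Complex.norm_exp_ofReal_mul_I, one_mul]
        refine Real.norm_exp_I_mul_ofReal_sub_one_le.trans_eq ?_
        rw [norm_mul, Real.norm_eq_abs t]
    _ = |t| * (eLpNorm (fun ω => f ω - g ω) 1 P).toReal := by
        rw [integral_const_mul, eLpNorm_one_eq_lintegral_enorm,
          integral_norm_eq_lintegral_enorm hfg.aestronglyMeasurable]
    _ ≤ |t| * (eLpNorm (fun ω => f ω - g ω) 2 P).toReal := by
        gcongr
        · exact hfg.eLpNorm_ne_top
        · exact eLpNorm_le_eLpNorm_of_exponent_le one_le_two hfg.aestronglyMeasurable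
    _ = |t| * ‖f - g‖ := by
        rw [Lp.norm_def]
        congr 2
        exact (eLpNorm_congr_ae (Lp.coeFn_sub f g)).symm

/-- `f` is a centered Gaussian random variable. -/
def IsCenteredGaussian (f : Lp ℝ 2 P) : Prop :=
  P.map f = gaussianReal 0 (‖f‖ ^ 2).toNNReal

theorem isCenteredGaussian_iff [IsProbabilityMeasure P] (f : Lp ℝ 2 P) : IsCenteredGaussian f ↔
    ∀ t : ℝ, ∫ ω, Complex.exp (t * f ω * Complex.I) ∂P =
      Complex.exp (-((‖f‖ ^ 2 : ℝ) * t ^ 2 / 2)) := by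
  have hm := (Lp.stronglyMeasurable f).measurable
  have : IsProbabilityMeasure (P.map f) := Measure.isProbabilityMeasure_map hm.aemeasurable
  have h1 : ∀ t : ℝ, charFun (P.map f) t = ∫ ω, Complex.exp (t * f ω * Complex.I) ∂P := by
    intro t
    rw [charFun_apply_real, integral_map hm.aemeasurable]
    exact Measurable.aestronglyMeasurable (by fun_prop)
  have h2 : ∀ t : ℝ, charFun (gaussianReal 0 (‖f‖ ^ 2).toNNReal) t =
      Complex.exp (-((‖f‖ ^ 2 : ℝ) * t ^ 2 / 2)) := by
    intro t
    rw [charFun_gaussianReal]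
    rw [Real.coe_toNNReal _ (sq_nonneg _)]
    congr 1
    simp
  constructor
  · intro h t
    rw [← h1, h, h2]
  · intro h
    exact Measure.ext_of_charFun (funext fun t => by rw [h1, h2, h])

/-- Both sides of the characteristic function identity are continuous in `f` for each `t`. This
carries Gaussianity from the linear span to its closure. -/
theorem isClosed_isCenteredGaussian [IsProbabilityMeasure P] : IsClosed {f : Lp ℝ 2 P | IsCenteredGaussian f} := by
  simp only [isCenteredGaussian_iff, Set.ofPred_forall]
  refine isClosed_iInter fun t => isClosed_eq (continuous_integral_exp_mul_I P t) ?_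
  fun_prop

theorem inner_toLp_two {X : Type*} [MeasurableSpace X] {ν : Measure X} {f g : X → ℝ}
    (hf : MemLp f 2 ν) (hg : MemLp g 2 ν) :
    inner ℝ (hf.toLp f) (hg.toLp g) = ∫ x, f x * g x ∂ν := by
  rw [L2.inner_def]
  refine integral_congr_ae ?_
  filter_upwards [hf.coeFn_toLp, hg.coeFn_toLp] with u h1 h2
  rw [h1, h2]
  simp [mul_comm]

theorem isCenteredGaussian_toLp {f : Ω → ℝ} (hf : MemLp f 2 P) (hg : HasGaussianLaw f P)
    (h0 : ∫ ω, f ω ∂P = 0) : IsCenteredGaussian (hf.toLp f) := by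
  rw [IsCenteredGaussian, Measure.map_congr hf.coeFn_toLp, hg.map_eq_gaussianReal, h0]
  rw [variance_of_integral_eq_zero hf.aemeasurable h0, ← real_inner_self_eq_norm_sq, inner_toLp_two]
  simp [sq]

section GaussianSpace

variable {T : Type*} {Y : T → Ω → ℝ}

theorem isCenteredGaussian_of_mem_span [IsProbabilityMeasure P] (hY : IsGaussianProcess Y P) (h0 : ∀ i, ∫ ω, Y i ω ∂P = 0)
    (hL : ∀ i, MemLp (Y i) 2 P) {f : Lp ℝ 2 P}
    (hf : f ∈ Submodule.span ℝ (Set.range fun i => (hL i).toLp (Y i))) : IsCenteredGaussian f := by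
  classical
  obtain ⟨c, rfl⟩ := Finsupp.mem_span_range_iff_exists_finsupp.1 hf
  have hm : MemLp (fun ω => ∑ i ∈ c.support, c i * Y i ω) 2 P :=
    memLp_finsetSum _ fun i _ => (hL i).const_mul (c i)
  have e : (c.sum fun i a => a • (hL i).toLp (Y i)) = hm.toLp _ := by
    refine Lp.ext ?_
    refine Filter.EventuallyEq.trans ?_ hm.coeFn_toLp.symm
    refine (Lp.coeFn_finsetSum _ _).trans ?_
    have : ∀ᵐ ω ∂P, ∀ i ∈ c.support, (c i • (hL i).toLp (Y i) : Lp ℝ 2 P) ω = c i * Y i ω := by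
      rw [Filter.eventually_all_finset]
      intro i _
      filter_upwards [Lp.coeFn_smul (c i) ((hL i).toLp (Y i)), (hL i).coeFn_toLp] with ω h1 h2
      rw [h1, Pi.smul_apply, h2, smul_eq_mul]
    filter_upwards [this] with ω hω
    rw [Finset.sum_apply]
    exact Finset.sum_congr rfl hω
  rw [e]
  refine isCenteredGaussian_toLp hm ?_ ?_
  · have h := (hY.hasGaussianLaw c.support).map_fun
      (∑ i : c.support, c i • ContinuousLinearMap.proj (R := ℝ) (φ := fun _ : c.support => ℝ) i)
    have hsum : ∀ y : c.support → ℝ, (∑ i : c.support, c i • ContinuousLinearMap.proj (R := ℝ)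
        (φ := fun _ : c.support => ℝ) i) y = ∑ i : c.support, c i * y i := by
      intro y
      simp
    have e2 : (fun ω => ∑ i ∈ c.support, c i * Y i ω) = fun ω =>
        (∑ i : c.support, c i • ContinuousLinearMap.proj (R := ℝ) (φ := fun _ : c.support => ℝ) i)
          (c.support.restrict fun i => Y i ω) := by
      funext ω
      rw [hsum]
      exact (Finset.sum_coe_sort c.support fun i => c i * Y i ω).symm
    rw [e2]
    exact h
  · rw [integral_finsetSum _ fun i _ => ((hL i).integrable one_le_two).const_mul _]
    simp [integral_const_mul, h0]

/-- The elements of a closed subspace consisting of centered Gaussian variables form a Gaussian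
process. -/
theorem isGaussianProcess_of_isCenteredGaussian (G : Submodule ℝ (Lp ℝ 2 P))
    (hG : ∀ f ∈ G, IsCenteredGaussian f) :
    IsGaussianProcess (fun f : G => ((f : Lp ℝ 2 P) : Ω → ℝ)) P where
  hasGaussianLaw I := by
    classical
    have hmeas : Measurable fun ω => I.restrict fun f : G => ((f : Lp ℝ 2 P) : Ω → ℝ) ω :=
      measurable_pi_lambda _ fun i => (Lp.stronglyMeasurable _).measurable
    refine ⟨isGaussian_of_map_eq_gaussianReal fun L => ?_⟩
    rw [Measure.map_map L.continuous.measurable hmeas]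
    -- A linear functional of finitely many members of `G` is again a member of `G`, with the values
    -- of `L` on basis vectors as coefficients.
    set g : G := ∑ i : I, L (fun j => if i = j then 1 else 0) • (i : G) with hg
    refine ⟨0, (‖(g : Lp ℝ 2 P)‖ ^ 2).toNNReal, ?_⟩
    rw [← show P.map (g : Lp ℝ 2 P) = _ from hG g g.2]
    refine Measure.map_congr ?_
    have e1 : (g : Lp ℝ 2 P) = ∑ i : I, L (fun j => if i = j then 1 else 0) • ((i : G) : Lp ℝ 2 P) := by
      simp [hg]
    rw [e1]
    refine Filter.EventuallyEq.symm ((Lp.coeFn_finsetSum _ _).trans ?_)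
    have : ∀ᵐ ω ∂P, ∀ i : I, (L (fun j => if i = j then 1 else 0) • ((i : G) : Lp ℝ 2 P) : Lp ℝ 2 P) ω =
        L (fun j => if i = j then 1 else 0) * ((i : G) : Lp ℝ 2 P) ω := by
      rw [Filter.eventually_all]
      intro i
      filter_upwards [Lp.coeFn_smul (L (fun j => if i = j then 1 else 0)) ((i : G) : Lp ℝ 2 P)] with ω h1
      rw [h1, Pi.smul_apply, smul_eq_mul]
    filter_upwards [this] with ω hω
    rw [Finset.sum_apply, Finset.sum_congr rfl fun i _ => hω i, Function.comp_apply]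
    refine Eq.trans ?_ (L.toLinearMap.pi_apply_eq_sum_univ _).symm
    exact Finset.sum_congr rfl fun i _ => mul_comm _ _

end GaussianSpace

end

/-- A bound on a functional which holds on a set of generators extends to the orthogonal
projection. -/
theorem norm_sq_starProjection_le {E : Type*} [NormedAddCommGroup E] [InnerProductSpace ℝ E]
    (S : Submodule ℝ E) [S.topologicalClosure.HasOrthogonalProjection] (g : E) {c : ℝ}
    (h : ∀ y ∈ S, (inner ℝ g y) ^ 2 ≤ c * ‖y‖ ^ 2) :
    ‖S.topologicalClosure.starProjection g‖ ^ 2 ≤ max c 0 := by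
  set x := S.topologicalClosure.starProjection g with hx
  have hxm : x ∈ S.topologicalClosure := Submodule.starProjection_apply_mem _ _
  have hcl : ∀ y ∈ S.topologicalClosure, (inner ℝ g y) ^ 2 ≤ c * ‖y‖ ^ 2 := by
    have hclosed : IsClosed {y : E | (inner ℝ g y) ^ 2 ≤ c * ‖y‖ ^ 2} :=
      isClosed_le (by fun_prop) (by fun_prop)
    intro y hy
    exact closure_minimal (s := (S : Set E)) (fun z hz => h z hz) hclosed hy
  -- The bound is tested on the projection itself, where the inner product with `g` equals `‖x‖²`.
  have h1 := hcl x hxm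
  have h2 : inner ℝ g x = ‖x‖ ^ 2 := by
    have h3 := Submodule.sub_starProjection_mem_orthogonal (K := S.topologicalClosure) g
    have h4 := (Submodule.mem_orthogonal' _ _).1 h3 x hxm
    rw [← hx, inner_sub_left, real_inner_self_eq_norm_sq] at h4
    linarith
  rw [h2] at h1
  rcases (sq_nonneg ‖x‖).eq_or_lt with h5 | h5
  · rw [← h5]
    exact le_max_right _ _
  · refine le_max_of_le_left ?_
    rw [sq (‖x‖ ^ 2)] at h1
    exact le_of_mul_le_mul_right h1 h5

theorem isCenteredGaussian_zero_integral {Ω : Type*} [MeasurableSpace Ω] {P : Measure Ω} {f : Lp ℝ 2 P} (hf : IsCenteredGaussian f) :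
    ∫ ω, f ω ∂P = 0 := by
  have hm := (Lp.stronglyMeasurable f).measurable
  have h := integral_map (μ := P) hm.aemeasurable (f := fun x : ℝ => x)
    (by fun_prop)
  rw [← h, hf, integral_id_gaussianReal]

/-- The conditional expectation of one value of a centered Gaussian process with respect to the
`σ`-algebra generated by a subfamily is centered Gaussian. -/
theorem condExp_gaussian {Ω : Type*} {F : MeasurableSpace Ω} [mΩ : MeasurableSpace Ω]
    {P : Measure Ω} [IsProbabilityMeasure P] {T : Type*} {Y : T → Ω → ℝ}
    (hY : IsGaussianProcess Y P) (hm : ∀ i, Measurable (Y i)) (h0 : ∀ i, ∫ ω, Y i ω ∂P = 0)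
    {U : Type*} (k : U → T)
    (hF : F = ⨆ r, MeasurableSpace.comap (Y (k r)) inferInstance) (i₀ : T) {c : ℝ}
    (hc : ∀ (I : Finset U) (x : U → ℝ), (∑ i ∈ I, x i * ∫ ω, Y i₀ ω * Y (k i) ω ∂P) ^ 2 ≤
      c * ∑ i ∈ I, ∑ j ∈ I, x i * x j * ∫ ω, Y (k i) ω * Y (k j) ω ∂P) :
    ∃ v : NNReal, (v : ℝ) ≤ max c 0 ∧
      P.map (P[Y i₀ | F]) = gaussianReal 0 v := by
  have hL : ∀ i, MemLp (Y i) 2 P := fun i => (hY.hasGaussianLaw_eval i).memLp_two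
  set y : T → Lp ℝ 2 P := fun i => (hL i).toLp (Y i) with hy
  have hFle : F ≤ mΩ := hF ▸ iSup_le fun r => (hm (k r)).comap_le
  set G : Submodule ℝ (Lp ℝ 2 P) := (Submodule.span ℝ (Set.range y)).topologicalClosure with hGdef
  have hG : ∀ f ∈ G, IsCenteredGaussian f := fun f hf =>
    closure_minimal (s := (Submodule.span ℝ (Set.range y) : Set (Lp ℝ 2 P)))
      (fun z hz => isCenteredGaussian_of_mem_span hY h0 hL hz) isClosed_isCenteredGaussian hf
  set S : Submodule ℝ (Lp ℝ 2 P) := Submodule.span ℝ (Set.range fun i => y (k i)) with hS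
  have hyG : ∀ i, y i ∈ G := fun i =>
    Submodule.le_topologicalClosure _ (Submodule.subset_span ⟨i, rfl⟩)
  have hSG : S.topologicalClosure ≤ G := by
    refine Submodule.topologicalClosure_mono (Submodule.span_mono ?_)
    rintro _ ⟨i, rfl⟩
    exact ⟨k i, rfl⟩
  have : CompleteSpace S.topologicalClosure := S.isClosed_topologicalClosure.completeSpace_coe
  set X : Lp ℝ 2 P := S.topologicalClosure.starProjection (y i₀) with hX
  have hXm : X ∈ S.topologicalClosure := Submodule.starProjection_apply_mem _ _
  have hDG : y i₀ - X ∈ G := G.sub_mem (hyG i₀) (hSG hXm)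
  refine ⟨(‖X‖ ^ 2).toNNReal, ?_, ?_⟩
  · rw [Real.coe_toNNReal _ (sq_nonneg _)]
    refine norm_sq_starProjection_le S (y i₀) fun z hz => ?_
    obtain ⟨x, rfl⟩ := Finsupp.mem_span_range_iff_exists_finsupp.1 hz
    have e1 : inner ℝ (y i₀) (x.sum fun i a => a • y (k i)) =
        ∑ i ∈ x.support, x i * ∫ ω, Y i₀ ω * Y (k i) ω ∂P := by
      rw [Finsupp.sum, inner_sum]
      exact Finset.sum_congr rfl fun i _ => by
        rw [real_inner_smul_right, inner_toLp_two]
    have e2 : ‖x.sum fun i a => a • y (k i)‖ ^ 2 = ∑ i ∈ x.support, ∑ j ∈ x.support,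
        x i * x j * ∫ ω, Y (k i) ω * Y (k j) ω ∂P := by
      rw [← real_inner_self_eq_norm_sq, Finsupp.sum, sum_inner]
      refine Finset.sum_congr rfl fun i _ => ?_
      rw [inner_sum]
      exact Finset.sum_congr rfl fun j _ => by
        rw [real_inner_smul_right, real_inner_smul_left, inner_toLp_two]
        ring
    rw [e1, e2]
    exact hc x.support x
  · have hXae : AEStronglyMeasurable[F] X P := by
      have hcl : IsClosed {f : Lp ℝ 2 P | AEStronglyMeasurable[F] f P} :=
        isClosed_aestronglyMeasurable hFle
      refine closure_minimal (s := (S : Set (Lp ℝ 2 P))) (fun z hz => ?_) hcl hXm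
      have hsub : S ≤ lpMeas ℝ ℝ F 2 P := by
        refine Submodule.span_le.2 ?_
        rintro _ ⟨i, rfl⟩
        refine mem_lpMeas_iff_aestronglyMeasurable.2 ?_
        have h1 : Measurable[F] (Y (k i)) :=
          (comap_measurable (Y (k i))).mono
            (hF ▸ le_iSup (fun r => MeasurableSpace.comap (Y (k r)) inferInstance) i) le_rfl
        exact ⟨Y (k i), h1.stronglyMeasurable, (hL (k i)).coeFn_toLp⟩
      exact mem_lpMeas_iff_aestronglyMeasurable.1 (hsub hz)
    have hcX : P[X | F] =ᵐ[P] X :=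
      condExp_of_aestronglyMeasurable' hFle hXae ((Lp.memLp X).integrable one_le_two)
    have hproc : IsGaussianProcess (Sum.elim (fun _ : Unit => ((y i₀ - X : Lp ℝ 2 P) : Ω → ℝ))
        fun r => Y (k r)) P := by
      have h1 := (isGaussianProcess_of_isCenteredGaussian G hG).comp_right
        (Sum.elim (fun _ : Unit => (⟨y i₀ - X, hDG⟩ : G)) fun r => ⟨y (k r), hyG (k r)⟩)
      refine h1.congr ?_
      rintro (_ | r)
      · exact Filter.EventuallyEq.rfl
      · exact (hL (k r)).coeFn_toLp
    have hDm : Measurable ((y i₀ - X : Lp ℝ 2 P) : Ω → ℝ) := (Lp.stronglyMeasurable _).measurable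
    have hD0 := isCenteredGaussian_zero_integral (hG _ hDG)
    -- The residual is orthogonal to the generators, and for a jointly Gaussian family zero
    -- covariance means independence.
    have hind := hproc.indepFun_of_covariance_eq_zero (fun _ => hDm.aemeasurable)
      (fun r => (hm (k r)).aemeasurable) fun _ r => by
        rw [covariance_eq_sub (Lp.memLp _) (hL (k r)), h0, mul_zero, sub_zero]
        have h3 := Submodule.sub_starProjection_mem_orthogonal (K := S.topologicalClosure) (y i₀)
        have h4 := (Submodule.mem_orthogonal' _ _).1 h3 (y (k r))
          (Submodule.le_topologicalClosure _ (Submodule.subset_span ⟨r, rfl⟩))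
        rw [← hX] at h4
        rw [← h4, ← Lp.toLp_coeFn (y i₀ - X) (Lp.memLp _), inner_toLp_two, Lp.toLp_coeFn]
        rfl
    have hcD : P[((y i₀ - X : Lp ℝ 2 P) : Ω → ℝ) | F] =ᵐ[P] fun _ => 0 := by
      have h5 : Indep (MeasurableSpace.comap ((y i₀ - X : Lp ℝ 2 P) : Ω → ℝ) inferInstance) F P := by
        have h6 : F = MeasurableSpace.comap (fun ω r => Y (k r) ω) MeasurableSpace.pi := by
          rw [hF, MeasurableSpace.pi, MeasurableSpace.comap_iSup]
          congr 1
          ext1 r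
          rw [MeasurableSpace.comap_comp]
          rfl
        rw [h6]
        have hev : Measurable fun f : Unit → ℝ => f () := measurable_pi_apply ()
        have h7 := hind.comp hev (measurable_id (α := U → ℝ))
        exact h7
      have h8 := condExp_indep_eq hDm.comap_le hFle
        (comap_measurable ((y i₀ - X : Lp ℝ 2 P) : Ω → ℝ)).stronglyMeasurable h5
      rw [hD0] at h8
      exact h8
    have hfin : P[Y i₀ | F] =ᵐ[P] X := by
      have h9 : Y i₀ =ᵐ[P] ((y i₀ - X : Lp ℝ 2 P) : Ω → ℝ) + (X : Ω → ℝ) := by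
        filter_upwards [Lp.coeFn_sub (y i₀) X, (hL i₀).coeFn_toLp] with ω h1 h2
        rw [Pi.add_apply, h1, Pi.sub_apply, h2, sub_add_cancel]
      refine (condExp_congr_ae h9).trans ((condExp_add
        ((Lp.memLp _).integrable one_le_two) ((Lp.memLp X).integrable one_le_two) F).trans ?_)
      filter_upwards [hcD, hcX] with ω h1 h2
      rw [Pi.add_apply, h1, h2, zero_add]
    rw [Measure.map_congr hfin]
    exact hG X (hSG hXm)

/-! ### Exponential moments and Jensen's inequality. -/

theorem lintegral_exp_sq_gaussianReal_lt_top {κ : ℝ} (hκ : κ < 1 / 2) :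
    ∫⁻ x, ENNReal.ofReal (Real.exp (κ * x ^ 2)) ∂gaussianReal 0 1 < ⊤ := by
  rw [gaussianReal_of_var_ne_zero 0 one_ne_zero, lintegral_withDensity_eq_lintegral_mul _
    (measurable_gaussianPDF 0 1) (by fun_prop)]
  have h : Integrable (fun x : ℝ => (√(2 * Real.pi))⁻¹ * Real.exp (-(1 / 2 - κ) * x ^ 2)) :=
    (integrable_exp_neg_mul_sq (by linarith)).const_mul _
  have h2 := h.hasFiniteIntegral
  rw [hasFiniteIntegral_iff_ofReal (Filter.Eventually.of_forall fun x => by positivity)] at h2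
  refine lt_of_eq_of_lt (lintegral_congr fun x => ?_) h2
  rw [Pi.mul_apply, gaussianPDF, ← ENNReal.ofReal_mul (gaussianPDFReal_nonneg _ _ _),
    gaussianPDFReal]
  congr 1
  rw [mul_assoc, ← Real.exp_add, NNReal.coe_one, mul_one]
  congr 2
  ring

/-- Rescaling to a standard normal gives a bound depending only on `κ`, hence uniform over times
with different variances, including zero variance. -/
theorem lintegral_exp_sq_gaussianReal_le {κ l : ℝ} {v : NNReal} (h : l * v ≤ κ) :
    ∫⁻ x, ENNReal.ofReal (Real.exp (l * x ^ 2)) ∂gaussianReal 0 v ≤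
      ∫⁻ x, ENNReal.ofReal (Real.exp (κ * x ^ 2)) ∂gaussianReal 0 1 := by
  have h1 : gaussianReal 0 v = (gaussianReal 0 1).map fun x => √v * x := by
    rw [gaussianReal_map_const_mul, mul_zero, mul_one]
    congr 1
    apply NNReal.eq
    simp
  rw [h1, lintegral_map (by fun_prop) (by fun_prop)]
  refine lintegral_mono fun x => ENNReal.ofReal_le_ofReal (Real.exp_le_exp.2 ?_)
  rw [mul_pow, Real.sq_sqrt v.coe_nonneg, ← mul_assoc]
  exact mul_le_mul_of_nonneg_right h (sq_nonneg x)

theorem aConst_one_sub (H : ℝ) : aConst (1 - H) = aConst H := by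
  unfold aConst
  rw [show 2 * (1 - H) + 1 = 3 - 2 * H by ring, show 3 - 2 * (1 - H) = 2 * H + 1 by ring,
    show Real.pi * (1 - H) = Real.pi - Real.pi * H by ring, Real.sin_pi_sub, mul_comm (Real.Gamma _)]

/-- The covariance of `Z_{1-H}(t)` with `Z_H(r)` has exponent `H + (1-H) = 1`, so it is `a_H (t + r
- (t-r))/2 = a_H r`. The projection bound then needs only `aConst_sq_mul_sq_sum_le`. -/
theorem fieldMartingale_map {Ω : Type*} [MeasurableSpace Ω] {P : Measure Ω}
    [IsProbabilityMeasure P] {Z : ℝ → ℝ → Ω → ℝ} (hZ : IsFractionalGaussianField Z P)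
    {H : ℝ} (hH : H ∈ Set.Ioo (0 : ℝ) 1) (hne : H ≠ 1 / 2)
    {M : ℝ → Ω → ℝ} (hM : IsFieldMartingale Z P H M) {t : ℝ} (ht : 0 ≤ t) :
    ∃ v : NNReal, (v : ℝ) ≤ 2 * cM H * t ^ (2 - 2 * H) ∧ P.map (M t) = gaussianReal 0 v := by
  have hH' : 1 - H ∈ Set.Ioo (0 : ℝ) 1 := ⟨by linarith [hH.2], by linarith [hH.1]⟩
  have hF : fieldSigmaAlgebra Z H t =
      ⨆ r : Set.Icc (0 : ℝ) t, MeasurableSpace.comap (Z H r) inferInstance := by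
    rw [fieldSigmaAlgebra, iSup_subtype']
  have hpos := cM_nonneg hH
  have hcov : ∀ s ∈ Set.Ici (0 : ℝ), ∀ r ∈ Set.Ici (0 : ℝ),
      ∫ ω, Z H s ω * Z H r ω ∂P = fbmCov H s r := by
    intro s hs r hr
    rw [hZ.covariance H hH H hH s hs r hr, fieldConst_self hH hne, fbmCov, ← two_mul]
    ring
  have hcross : ∀ r ∈ Set.Icc (0 : ℝ) t, ∫ ω, Z (1 - H) t ω * Z H r ω ∂P = aConst H * r := by
    intro r hr
    have h1 := fieldConst_one_sub (1 - H)
    rw [sub_sub_cancel, aConst_one_sub] at h1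
    rw [hZ.covariance (1 - H) hH' H hH t ht r hr.1, h1, sub_add_cancel, Real.rpow_one,
      Real.rpow_one, Real.rpow_one, abs_of_nonneg ht, abs_of_nonneg hr.1,
      abs_of_nonneg (by linarith [hr.2] : 0 ≤ t - r)]
    ring
  obtain ⟨v, hv, hmap⟩ := condExp_gaussian hZ.gaussian
    (fun p => hZ.measurable _ p.1.2 _ p.2.2) (fun p => hZ.centered _ p.1.2 _ p.2.2)
    (fun r : Set.Icc (0 : ℝ) t => ((⟨H, hH⟩ : Set.Ioo (0 : ℝ) 1), (⟨r, r.2.1⟩ : Set.Ici (0 : ℝ))))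
    hF (⟨1 - H, hH'⟩, ⟨t, ht⟩) (c := 2 * cM H * t ^ (2 - 2 * H)) (by
      intro I x
      have e1 : ∀ i ∈ I, x i * ∫ ω, Z (1 - H) t ω * Z H i ω ∂P = aConst H * (x i * i) :=
        fun i _ => by rw [hcross i i.2]; ring
      have e2 : ∀ i ∈ I, ∀ j ∈ I, x i * x j * ∫ ω, Z H i ω * Z H j ω ∂P =
          x i * x j * fbmCov H i j := fun i _ j _ => by rw [hcov i i.2.1 j j.2.1]
      rw [Finset.sum_congr rfl e1, ← Finset.mul_sum,
        Finset.sum_congr rfl fun i hi => Finset.sum_congr rfl (e2 i hi)]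
      refine aConst_sq_mul_sq_sum_le hH hne ht I x (fun i => (i : ℝ)) (fun i _ => i.2) ?_
      have hL : ∀ i : Set.Icc (0 : ℝ) t, MemLp (Z H i) 2 P := fun i =>
        (hZ.gaussian.hasGaussianLaw_eval (⟨H, hH⟩, ⟨i, i.2.1⟩)).memLp_two
      have e3 : ∑ i ∈ I, ∑ j ∈ I, x i * x j * fbmCov H i j =
          ∫ ω, (∑ i ∈ I, x i * Z H i ω) ^ 2 ∂P := by
        rw [← Finset.sum_congr rfl fun i hi => Finset.sum_congr rfl (e2 i hi)]
        simp only [sq, Finset.sum_mul_sum]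
        rw [integral_finsetSum]
        · refine Finset.sum_congr rfl fun i _ => ?_
          rw [integral_finsetSum]
          · refine Finset.sum_congr rfl fun j _ => ?_
            rw [← integral_const_mul]
            congr 1
            ext ω
            ring
          · intro j _
            exact ((hL i).const_mul _).integrable_mul ((hL j).const_mul _)
        · intro i _
          exact integrable_finsetSum _ fun j _ =>
            ((hL i).const_mul _).integrable_mul ((hL j).const_mul _)
      rw [e3]
      exact integral_nonneg fun ω => sq_nonneg _)
  refine ⟨v, hv.trans_eq (max_eq_left (by positivity)), ?_⟩
  rw [Measure.map_congr (hM.condExp_eq t ht)]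
  exact hmap

/-- Jensen's inequality for the exponential, combined with Tonelli's theorem. -/
theorem lintegral_exp_integral_le {S Ω : Type*} [MeasurableSpace S] [MeasurableSpace Ω]
    {ν : Measure S} [IsProbabilityMeasure ν] {P : Measure Ω} [IsProbabilityMeasure P]
    {f : S × Ω → ℝ} (hf : AEMeasurable f (ν.prod P)) (h0 : ∀ p, 0 ≤ f p) {K : ENNReal}
    (hK : K < ⊤) (h : ∀ᵐ s ∂ν, ∫⁻ ω, ENNReal.ofReal (Real.exp (f (s, ω))) ∂P ≤ K) :
    (∀ᵐ ω ∂P, Integrable (fun s => f (s, ω)) ν) ∧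
      ∫⁻ ω, ENNReal.ofReal (Real.exp (∫ s, f (s, ω) ∂ν)) ∂P ≤ K := by
  have hexp : AEMeasurable (fun p => ENNReal.ofReal (Real.exp (f p))) (ν.prod P) :=
    (Real.measurable_exp.comp_aemeasurable hf).ennreal_ofReal
  have hle : ∫⁻ ω, ∫⁻ s, ENNReal.ofReal (Real.exp (f (s, ω))) ∂ν ∂P ≤ K := by
    rw [← lintegral_lintegral_swap hexp]
    refine (lintegral_mono_ae h).trans ?_
    simp
  have hfin : ∀ᵐ ω ∂P, ∫⁻ s, ENNReal.ofReal (Real.exp (f (s, ω))) ∂ν < ⊤ :=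
    ae_lt_top' hexp.prod_swap.lintegral_prod_right' (hle.trans_lt hK).ne
  have hmeas : ∀ᵐ ω ∂P, AEStronglyMeasurable (fun s => f (s, ω)) ν :=
    hf.aestronglyMeasurable.prod_swap.prodMk_left
  have hint : ∀ᵐ ω ∂P, Integrable (fun s => f (s, ω)) ν ∧
      Integrable (fun s => Real.exp (f (s, ω))) ν := by
    filter_upwards [hfin, hmeas] with ω h1 h2
    have h3 : Integrable (fun s => Real.exp (f (s, ω))) ν := by
      refine ⟨Real.continuous_exp.comp_aestronglyMeasurable h2, ?_⟩
      rw [hasFiniteIntegral_iff_ofReal (Filter.Eventually.of_forall fun s => (Real.exp_pos _).le)]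
      exact h1
    -- Integrability of `f` follows from that of `exp f`, since `0 ≤ f ≤ exp f`.
    refine ⟨h3.mono' h2 (Filter.Eventually.of_forall fun s => ?_), h3⟩
    rw [Real.norm_of_nonneg (h0 _)]
    linarith [Real.add_one_le_exp (f (s, ω))]
  refine ⟨hint.mono fun ω hω => hω.1, le_trans (lintegral_mono_ae ?_) hle⟩
  filter_upwards [hint] with ω hω
  rw [← ofReal_integral_eq_lintegral_ofReal hω.2
    (Filter.Eventually.of_forall fun s => (Real.exp_pos _).le)]
  exact ENNReal.ofReal_le_ofReal (convexOn_exp.map_integral_le Real.continuous_exp.continuousOn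
    isClosed_univ (Filter.Eventually.of_forall fun s => Set.mem_univ _) hω.1 hω.2)

open Set in
-- The density `1/(sL)` is the scale-invariant choice: what is left, `s^{2H-2} M_s²`, has mean at
-- most `2 c_M`, so a single Gaussian bound serves all `s`.
theorem exp_integral_sq_fieldMartingale {Ω : Type*} [MeasurableSpace Ω] {P : Measure Ω}
    [IsProbabilityMeasure P] {Z : ℝ → ℝ → Ω → ℝ} (hZ : IsFractionalGaussianField Z P)
    {H : ℝ} (hH : H ∈ Ioo (0 : ℝ) 1) (hne : H ≠ 1 / 2)
    {M : ℝ → Ω → ℝ} (hM : IsFieldMartingale Z P H M) {ε t b : ℝ} (hε : 0 < ε) (hεt : ε < t)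
    (hb : 0 < b) (hbt : b * cM H * Real.log (t / ε) < 1 / 2) :
    (∀ᵐ ω ∂P, IntegrableOn (fun s => b / 2 * (s ^ (2 * H - 3) * M s ω ^ 2)) (Icc ε t)) ∧
      ∫⁻ ω, ENNReal.ofReal
        (Real.exp (∫ s in Icc ε t, b / 2 * (s ^ (2 * H - 3) * M s ω ^ 2))) ∂P < ⊤ := by
  have ht : 0 < t := hε.trans hεt
  set L := Real.log (t / ε) with hLdef
  have hL : 0 < L := Real.log_pos ((one_lt_div hε).2 hεt)
  set d : ℝ → ENNReal := fun s => ENNReal.ofReal (s⁻¹ / L) with hd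
  have hdm : Measurable d := by fun_prop
  set ν := (volume.restrict (Icc ε t)).withDensity d with hν
  have hdL : ∀ s ∈ Icc ε t, 0 ≤ s⁻¹ / L := fun s hs =>
    div_nonneg (inv_nonneg.2 (hε.le.trans hs.1)) hL.le
  have hprob : IsProbabilityMeasure ν := by
    refine ⟨?_⟩
    have hi : IntervalIntegrable (fun s : ℝ => s⁻¹ / L) volume ε t := by
      apply ContinuousOn.intervalIntegrable
      rw [uIcc_of_le hεt.le]
      exact (continuousOn_inv₀.mono fun s hs => (hε.trans_le hs.1).ne').div_const L
    rw [hν, withDensity_apply _ MeasurableSet.univ, Measure.restrict_univ, hd,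
      ← ofReal_integral_eq_lintegral_ofReal, integral_Icc_eq_integral_Ioc,
      ← intervalIntegral.integral_of_le hεt.le, intervalIntegral.integral_div,
      integral_inv_of_pos hε ht, ← hLdef, div_self hL.ne', ENNReal.ofReal_one]
    · exact (intervalIntegrable_iff_integrableOn_Icc_of_le hεt.le).1 hi
    · exact (ae_restrict_iff' measurableSet_Icc).2 (Filter.Eventually.of_forall hdL)
  have hac : ν ≪ volume.restrict (Ici (0 : ℝ)) :=
    (withDensity_absolutelyContinuous _ _).trans
      (Measure.absolutelyContinuous_of_le (Measure.restrict_mono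
        (fun s hs => hε.le.trans hs.1) le_rfl))
  have hMm : AEMeasurable (fun p : ℝ × Ω => M p.1 p.2) (ν.prod P) :=
    hM.jointly_measurable.mono_ac (hac.prod Measure.AbsolutelyContinuous.rfl)
  -- The absolute value makes `f` nonnegative also at negative times, where a real power may be
  -- negative; it has no effect on `[ε,t]`.
  set f : ℝ × Ω → ℝ := fun p => b * L / 2 * (|p.1 ^ (2 * H - 2)| * M p.1 p.2 ^ 2) with hf
  have hfm : AEMeasurable f (ν.prod P) := by
    have : Measurable fun p : ℝ × Ω => |p.1 ^ (2 * H - 2)| := by fun_prop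
    exact (this.aemeasurable.mul (hMm.pow_const 2)).const_mul _
  have hmem : ∀ᵐ s ∂ν, s ∈ Icc ε t :=
    (withDensity_absolutelyContinuous _ _).ae_le (ae_restrict_mem measurableSet_Icc)
  obtain ⟨h1, h2⟩ := lintegral_exp_integral_le hfm (fun p => by positivity)
    (lintegral_exp_sq_gaussianReal_lt_top hbt) (by
      filter_upwards [hmem] with s hs
      have hs0 : 0 < s := hε.trans_le hs.1
      obtain ⟨v, hv, hmap⟩ := fieldMartingale_map hZ hH hne hM hs0.le
      have hMs : AEMeasurable (M s) P := aemeasurable_of_map_neZero (by rw [hmap]; infer_instance)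
      refine le_trans (le_of_eq ?_) (lintegral_exp_sq_gaussianReal_le (v := v)
        (l := b * L / 2 * s ^ (2 * H - 2)) ?_)
      · rw [← hmap, lintegral_map' (by fun_prop) hMs]
        refine lintegral_congr fun ω => ?_
        simp only [hf]
        rw [abs_of_pos (by positivity), mul_assoc (b * L / 2)]
      · have hss : s ^ (2 * H - 2) * s ^ (2 - 2 * H) = 1 := by
          rw [← Real.rpow_add hs0]
          convert Real.rpow_zero s using 2
          ring
        calc b * L / 2 * s ^ (2 * H - 2) * v
            ≤ b * L / 2 * s ^ (2 * H - 2) * (2 * cM H * s ^ (2 - 2 * H)) := by gcongr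
          _ = b * cM H * L * (s ^ (2 * H - 2) * s ^ (2 - 2 * H)) := by ring
          _ = b * cM H * L := by rw [hss, mul_one])
  have key : ∀ s ∈ Icc ε t, ∀ ω, (d s).toReal • f (s, ω) =
      b / 2 * (s ^ (2 * H - 3) * M s ω ^ 2) := by
    intro s hs ω
    have hs0 : 0 < s := hε.trans_le hs.1
    simp only [hd, hf]
    rw [ENNReal.toReal_ofReal (hdL s hs), abs_of_pos (by positivity), smul_eq_mul,
      show 2 * H - 3 = -1 + (2 * H - 2) by ring, Real.rpow_add hs0, Real.rpow_neg_one]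
    field_simp
  have hdtop : ∀ᵐ s ∂(volume.restrict (Icc ε t)), d s < ⊤ :=
    Filter.Eventually.of_forall fun s => ENNReal.ofReal_lt_top
  refine ⟨?_, ?_⟩
  · filter_upwards [h1] with ω hω
    rw [hν, integrable_withDensity_iff_integrable_smul' hdm hdtop] at hω
    exact (integrableOn_congr_fun (fun s hs => key s hs ω) measurableSet_Icc).1 hω
  · refine lt_of_eq_of_lt (lintegral_congr fun ω => ?_)
      (h2.trans_lt (lintegral_exp_sq_gaussianReal_lt_top hbt))
    rw [hν, integral_withDensity_eq_integral_toReal_smul hdm hdtop,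
      setIntegral_congr_fun measurableSet_Icc fun s hs => key s hs ω]

/-! ### The threshold for `ε` and the main estimate. -/

theorem mul_log_lt_half {q T ε : ℝ} (hq : 0 ≤ q) (hT : 0 < T) (hε : Real.exp (-1 / (2 * q)) * T < ε) :
    q * Real.log (T / ε) < 1 / 2 := by
  have hε0 : 0 < ε := lt_trans (by positivity) hε
  rcases hq.eq_or_lt with h | h
  · rw [← h]
    norm_num
  · have h1 : T / ε < Real.exp (1 / (2 * q)) := by
      rw [div_lt_iff₀ hε0]
      have h2 : Real.exp (1 / (2 * q)) * (Real.exp (-1 / (2 * q)) * T) = T := by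
        rw [← mul_assoc, ← Real.exp_add]
        rw [show 1 / (2 * q) + -1 / (2 * q) = 0 by ring, Real.exp_zero, one_mul]
      calc T = Real.exp (1 / (2 * q)) * (Real.exp (-1 / (2 * q)) * T) := h2.symm
        _ < _ := mul_lt_mul_of_pos_left hε (Real.exp_pos _)
    have h3 := Real.log_lt_log (by positivity) h1
    rw [Real.log_exp] at h3
    calc q * Real.log (T / ε) < q * (1 / (2 * q)) := mul_lt_mul_of_pos_left h3 h
      _ = 1 / 2 := by field_simp

theorem add_sq_le_of_pos {x y δ : ℝ} (hδ : 0 < δ) :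
    (x + y) ^ 2 ≤ (1 + 1 / δ) * x ^ 2 + (1 + δ) * y ^ 2 := by
  have h : (1 + 1 / δ) * x ^ 2 + (1 + δ) * y ^ 2 - (x + y) ^ 2 = (x - δ * y) ^ 2 / δ := by
    field_simp
    ring
  have : 0 ≤ (x - δ * y) ^ 2 / δ := by positivity
  linarith

open Set in
theorem mainTheorem4 {Ω : Type*} [MeasurableSpace Ω] (P : Measure Ω) [IsProbabilityMeasure P]
    (Z : ℝ → ℝ → Ω → ℝ) (hZ : IsFractionalGaussianField Z P)
    (H : ℝ) (hH : H ∈ Set.Ioo (0 : ℝ) 1) (hH_half : H ≠ 1 / 2)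
    (M : ℝ → Ω → ℝ) (hM : IsFieldMartingale Z P H M)
    (μ r σ : ℝ) (hr : 0 < r) (hσ : 0 < σ)
    (T ε : ℝ) (hT : 0 < T) (hε : Real.exp (-1 / (2 * driftB H ^ 2 * cM H)) * T < ε)
    (t : ℝ) (ht : 0 < t) (htT : t ≤ T) :
    (∀ᵐ ω ∂P, IntervalIntegrable (fun s => driftCorrection H μ r σ ε M s ω ^ 2) volume 0 t) ∧
    Integrable
      (fun ω => Real.exp (1 / 2 * ∫ s in (0 : ℝ)..t, driftCorrection H μ r σ ε M s ω ^ 2)) P := by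
  have hε0 : 0 < ε := lt_trans (by positivity) hε
  have hc := cM_nonneg hH
  set A := driftA H μ r σ with hA
  set B := driftB H with hB
  -- The strict threshold inequality persists when `B²` is enlarged to `B² + η`; this pays for the
  -- cross term in the square.
  obtain ⟨η, hη, hηb⟩ : ∃ η > 0, ε < t → (B ^ 2 + η) * cM H * Real.log (t / ε) < 1 / 2 := by
    rcases lt_or_ge ε t with h | h
    · have h1 : B ^ 2 * cM H * Real.log (T / ε) < 1 / 2 :=
        mul_log_lt_half (by positivity) hT (by rwa [← mul_assoc])
      have hL : 0 < Real.log (t / ε) := Real.log_pos ((one_lt_div hε0).2 h)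
      have h2 : B ^ 2 * cM H * Real.log (t / ε) < 1 / 2 := by
        refine lt_of_le_of_lt ?_ h1
        gcongr
      have h3 : 0 < cM H * Real.log (t / ε) + 1 := by positivity
      -- With `k = c_M log (t/ε)`, this `η` is the slack divided by `k + 1`, so `η k` stays below
      -- the slack even if `k = 0`.
      refine ⟨(1 / 2 - B ^ 2 * cM H * Real.log (t / ε)) / (cM H * Real.log (t / ε) + 1),
        div_pos (by linarith) h3, fun _ => ?_⟩
      set k := cM H * Real.log (t / ε)
      have h4 : B ^ 2 * cM H * Real.log (t / ε) = B ^ 2 * k := mul_assoc _ _ _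
      rw [h4] at h2 ⊢
      have h5 : (1 / 2 - B ^ 2 * k) / (k + 1) * k < 1 / 2 - B ^ 2 * k := by
        rw [div_mul_eq_mul_div, div_lt_iff₀ h3]
        nlinarith
      calc _ = B ^ 2 * k + (1 / 2 - B ^ 2 * k) / (k + 1) * k := by ring
        _ < _ := by linarith
    · exact ⟨1, one_pos, fun h' => absurd h (not_le.2 h')⟩
  set b := B ^ 2 + η with hb
  have hb0 : 0 < b := by positivity
  obtain ⟨hint, hfin⟩ : (∀ᵐ ω ∂P,
      IntegrableOn (fun s => b / 2 * (s ^ (2 * H - 3) * M s ω ^ 2)) (Icc ε t)) ∧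
      ∫⁻ ω, ENNReal.ofReal
        (Real.exp (∫ s in Icc ε t, b / 2 * (s ^ (2 * H - 3) * M s ω ^ 2))) ∂P < ⊤ := by
    rcases lt_or_ge ε t with h | h
    · exact exp_integral_sq_fieldMartingale hZ hH hH_half hM hε0 h hb0 (hηb h)
    -- When `t ≤ ε` the random part of the drift lives on a null set of times, and both claims are
    -- trivial.
    · have h0 : volume.restrict (Icc ε t) = 0 := by
        rw [Measure.restrict_eq_zero, Real.volume_Icc, ENNReal.ofReal_eq_zero]
        linarith
      simp [IntegrableOn, h0]
  -- This is the weight in `add_sq_le_of_pos`: the random term may be inflated by `1 + δ` up to the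
  -- coefficient `b`, and the deterministic term absorbs `1 + 1/δ`, which only has to be finite.
  obtain ⟨δ, hδ, hδb⟩ : ∃ δ > 0, (1 + δ) * B ^ 2 ≤ b := by
    refine ⟨η / (B ^ 2 + 1), by positivity, ?_⟩
    have : η / (B ^ 2 + 1) * B ^ 2 ≤ η := by
      rw [div_mul_eq_mul_div, div_le_iff₀ (by positivity)]
      nlinarith [sq_nonneg B]
    rw [add_mul, one_mul]
    linarith
  set c₁ := (1 + 1 / δ) * A ^ 2 with hc₁
  have hbound : ∀ s ∈ Ioc 0 t, ∀ ω, driftCorrection H μ r σ ε M s ω ^ 2 ≤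
      c₁ * s ^ (1 - 2 * H) +
        2 * (Icc ε t).indicator (fun s => b / 2 * (s ^ (2 * H - 3) * M s ω ^ 2)) s := by
    intro s hs ω
    have hs0 : 0 < s := hs.1
    refine (add_sq_le_of_pos hδ).trans (add_le_add (le_of_eq ?_) ?_)
    · rw [mul_pow, hc₁, ← mul_assoc, ← Real.rpow_natCast (s ^ _), ← Real.rpow_mul hs0.le]
      congr 2
      push_cast
      ring
    · by_cases hsε : ε ≤ s
      · rw [indicator_of_mem (mem_Ici.2 hsε), indicator_of_mem (mem_Icc.2 ⟨hsε, hs.2⟩), mul_one,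
          mul_pow, mul_pow, ← Real.rpow_natCast (s ^ _), ← Real.rpow_mul hs0.le]
        have e : (H - 3 / 2) * ((2 : ℕ) : ℝ) = 2 * H - 3 := by push_cast; ring
        rw [e]
        have : 0 ≤ s ^ (2 * H - 3) * M s ω ^ 2 := by positivity
        nlinarith [mul_le_mul_of_nonneg_right hδb this]
      · rw [indicator_of_notMem (by simpa using hsε), indicator_of_notMem fun h => hsε h.1]
        simp
  have hac : volume.restrict (Ioc 0 t) ≪ volume.restrict (Ici (0 : ℝ)) :=
    Measure.absolutelyContinuous_of_le (Measure.restrict_mono (fun s hs => hs.1.le) le_rfl)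
  have hγm : AEMeasurable (fun p : ℝ × Ω => driftCorrection H μ r σ ε M p.1 p.2 ^ 2)
      ((volume.restrict (Ioc 0 t)).prod P) := by
    have hMm := hM.jointly_measurable.mono_ac
      (hac.prod (Measure.AbsolutelyContinuous.rfl (μ := P)))
    have hind : Measurable fun p : ℝ × Ω => (Ici ε).indicator (fun _ => (1 : ℝ)) p.1 :=
      (measurable_const.indicator measurableSet_Ici).comp measurable_fst
    have h1 : Measurable fun p : ℝ × Ω => A * p.1 ^ (1 / 2 - H) := by fun_prop
    have h2 : Measurable fun p : ℝ × Ω => B * p.1 ^ (H - 3 / 2) := by fun_prop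
    exact (h1.aemeasurable.add ((h2.aemeasurable.mul hMm).mul hind.aemeasurable)).pow_const 2
  -- The deterministic part is integrable at `0` because `1 - 2H > -1`.
  have hpowint : IntegrableOn (fun s : ℝ => s ^ (1 - 2 * H)) (Ioc 0 t) :=
    (intervalIntegrable_iff_integrableOn_Ioc_of_le ht.le).1
      (intervalIntegral.intervalIntegrable_rpow' (by linarith [hH.2]))
  have hsub : Icc ε t ⊆ Ioc 0 t := fun s hs => ⟨hε0.trans_le hs.1, hs.2⟩
  have hmain : ∀ᵐ ω ∂P, IntegrableOn (fun s => driftCorrection H μ r σ ε M s ω ^ 2) (Ioc 0 t) ∧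
      ∫ s in Ioc 0 t, driftCorrection H μ r σ ε M s ω ^ 2 ≤ c₁ * (∫ s in Ioc 0 t, s ^ (1 - 2 * H)) +
        2 * ∫ s in Icc ε t, b / 2 * (s ^ (2 * H - 3) * M s ω ^ 2) := by
    filter_upwards [hint, hγm.aestronglyMeasurable.prod_swap.prodMk_left] with ω h1 h2
    have h3 : IntegrableOn ((Icc ε t).indicator
        fun s => b / 2 * (s ^ (2 * H - 3) * M s ω ^ 2)) (Ioc 0 t) :=
      ((integrable_indicator_iff measurableSet_Icc).2 h1).integrableOn
    have h4 := (hpowint.const_mul c₁).add (h3.const_mul 2)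
    have h5 : ∀ᵐ s ∂(volume.restrict (Ioc 0 t)), driftCorrection H μ r σ ε M s ω ^ 2 ≤
        c₁ * s ^ (1 - 2 * H) +
          2 * (Icc ε t).indicator (fun s => b / 2 * (s ^ (2 * H - 3) * M s ω ^ 2)) s :=
      (ae_restrict_iff' measurableSet_Ioc).2
        (Filter.Eventually.of_forall fun s hs => hbound s hs ω)
    have h6 : IntegrableOn (fun s => driftCorrection H μ r σ ε M s ω ^ 2) (Ioc 0 t) := by
      refine h4.mono' h2 (h5.mono fun s hs => ?_)
      rw [Real.norm_of_nonneg (sq_nonneg _)]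
      exact hs
    refine ⟨h6, (integral_mono_ae h6 h4 h5).trans_eq ?_⟩
    simp only [Pi.add_apply]
    rw [integral_add (hpowint.const_mul c₁) (h3.const_mul 2), integral_const_mul,
      integral_const_mul, setIntegral_indicator measurableSet_Icc, inter_eq_self_of_subset_right hsub]
  refine ⟨hmain.mono fun ω hω => (intervalIntegrable_iff_integrableOn_Ioc_of_le ht.le).2 hω.1, ?_⟩
  simp only [intervalIntegral.integral_of_le ht.le]
  have hmeas : AEStronglyMeasurable
      (fun ω => ∫ s in Ioc 0 t, driftCorrection H μ r σ ε M s ω ^ 2) P :=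
    hγm.aestronglyMeasurable.prod_swap.integral_prod_right'
  refine ⟨Real.continuous_exp.comp_aestronglyMeasurable (hmeas.const_mul _), ?_⟩
  rw [hasFiniteIntegral_iff_ofReal (Filter.Eventually.of_forall fun ω => (Real.exp_pos _).le)]
  set c₂ := 1 / 2 * (c₁ * ∫ s in Ioc 0 t, s ^ (1 - 2 * H)) with hc₂
  calc ∫⁻ ω, ENNReal.ofReal
        (Real.exp (1 / 2 * ∫ s in Ioc 0 t, driftCorrection H μ r σ ε M s ω ^ 2)) ∂P
      ≤ ∫⁻ ω, ENNReal.ofReal (Real.exp c₂) * ENNReal.ofReal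
        (Real.exp (∫ s in Icc ε t, b / 2 * (s ^ (2 * H - 3) * M s ω ^ 2))) ∂P := by
        refine lintegral_mono_ae (hmain.mono fun ω hω => ?_)
        rw [← ENNReal.ofReal_mul (Real.exp_pos _).le, ← Real.exp_add]
        exact ENNReal.ofReal_le_ofReal (Real.exp_le_exp.2 (by linarith [hω.2]))
    _ < ⊤ := by
        rw [lintegral_const_mul' _ _ ENNReal.ofReal_ne_top]
        exact ENNReal.mul_lt_top ENNReal.ofReal_lt_top hfin
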